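/- **Theorem (Gibbs–Bogoliubov inequality on the Nishimori line).** Let $\Phi$ be a closed subgroup of the circle group $\mathbb R/2\pi\mathbb Z$ and $\mu$ a Haar measure on $\Phi$ (any normalization). Let $\Lambda$ be a finite set of sites and $\Lambda_B$ a finite set of bonds $\langle ij\rangle$, $i,j\in\Lambda$ (unordered pairs, each counted once with a fixed but arbitrary order of its end points). Configurations are $\phi=(\phi_i)_{i\in\Lambda}\in\Phi^\Lambda$, with the product measure $d\mu(\phi)=\prod_{i\in\Lambda} d\mu(\phi_i)$. For every bond let $\beta_{ij,m}\ge 0$ $(m\in\mathbb Z)$ be non-zero for only finitely many $m$; primed sums run over the $m$ with non-zero (local) inverse temperature. The two-body random potential is $$U=-\sum_{\langle ij\rangle\in\Lambda_B}\sum_m{}'\beta_{ij,m}\bigl(J_{ij,m}\cos m(\phi_i-\phi_j)+K_{ij,m}\sin m(\phi_i-\phi_j)\bigr),$$ where all $J_{ij,m},K_{ij,m}$ are independent Gaussian variables of variance $\sigma_{ij,m}^2$ $(\sigma_{ij,m}\ge0)$ with means $D_{ij,m}$ and $0$ respectively, on the Nishimori line $D_{ij,m}=\beta_{ij,m}\sigma_{ij,m}^2$;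 put $x_{ij,m}=\beta_{ij,m}D_{ij,m}=\beta_{ij,m}^2\sigma_{ij,m}^2$. The one-body trial potential is $$U_0=-\sum_{i\in\Lambda}\sum_m{}'\beta_{i,m}\bigl(J_{i,m}\cos m\phi_i+K_{i,m}\sin m\phi_i\bigr),$$ where likewise $\beta_{i,m}\ge0$ is non-zero for finitely many $m$, the $J_{i,m},K_{i,m}$ are independent Gaussian variables of variance $\sigma_{i,m}^2$ with means $D_{i,m}=\beta_{i,m}\sigma_{i,m}^2$ and $0$, and $x_{i,m}=\beta_{i,m}D_{i,m}=\beta_{i,m}^2\sigma_{i,m}^2$. Let $$Z=\int e^{-U}d\mu(\phi),\qquad Z_0=\int e^{-U_0}d\mu(\phi),\qquad \langle f\rangle_0=\frac1{Z_0}\int f\,e^{-U_0}d\mu(\phi),$$ and let $\mathbb E$ be the expectation over the Gaussian variables. Then $Z,Z_0>0$, all expectations below exist, and $$\mathbb E[\log Z]\ \ge\ \mathbb E[\log Z_0]+\frac12\sum_{\langle ij\rangle\in\Lambda_B}\sum_m{}'x_{ij,m}\,\mathbb E\bigl[1+\langle\cos m(\phi_i-\phi_j)\rangle_0\bigr]-\frac12\sum_{i\in\Lambda}\sum_m{}'x_{i,m}\,\mathbb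 E\bigl[1+\langle\cos m\phi_i\rangle_0\bigr].$$ Consequently, the replica-symmetric mean-field free energy bounds the quenched free energy from above: if every site belongs to exactly $z$ bonds and $x_{ij,m}=x_m$ for all bonds, then for all order parameters $M_m\ge0$ $$-\mathbb E[\log Z]\ \le\ |\Lambda|\,f_{\rm RS}(M),$$ $$f_{\rm RS}(M)=-\,\mathbb E\log\int_\Phi\exp\Bigl(\sum_m{}'\bigl[h_m\cos m\varphi+\sqrt{h_m}\,(J_m\cos m\varphi+K_m\sin m\varphi)\bigr]\Bigr)d\mu(\varphi)-\frac z4\sum_m{}'x_m\,(1-2M_m-M_m^2),$$ where $h_m=z\,x_mM_m$ and $J_m,K_m$ are independent standard Gaussian variables (here the primed sums run over the $m$ with $x_m\ne0$). -/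

import Mathlib

open MeasureTheory ProbabilityTheory
open scoped NNReal

namespace GaugeGlass

/-- The Borel sigma-algebra on the circle `ℝ / 2πℤ`. -/
noncomputable instance instMeasurableSpaceAngle : MeasurableSpace Real.Angle := borel Real.Angle

instance instBorelSpaceAngle : BorelSpace Real.Angle := ⟨rfl⟩

noncomputable section

/-! ### Random potentials with Gaussian disorder

`S` is the space of spin configurations with a priori measure `ρ`, and `ι` is the finite set of
interaction terms.  The term `a` has local inverse temperature `β a` and couples to the phase
`θ a φ` of the configuration `φ`.  A disorder sample `ω` gives the pair
`ω a = (J a, K a)`. -/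

section General

variable {ι S : Type*} [Fintype ι] [MeasurableSpace S]

/-- `U(φ) = - ∑ₐ βₐ (Jₐ cos θₐ(φ) + Kₐ sin θₐ(φ))`. -/
def potential (β : ι → ℝ) (θ : ι → S → Real.Angle) (ω : ι → ℝ × ℝ) (φ : S) : ℝ :=
  -∑ a, β a * ((ω a).1 * (θ a φ).cos + (ω a).2 * (θ a φ).sin)

/-- The partition function `Z = ∫ exp (-U) dρ`. -/
def partitionFn (ρ : Measure S) (β : ι → ℝ) (θ : ι → S → Real.Angle) (ω : ι → ℝ × ℝ) : ℝ :=
  ∫ φ, Real.exp (-potential β θ ω φ) ∂ρ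

/-- The thermal average `⟨f⟩ = (∫ f exp (-U) dρ) / Z`. -/
def thermalAvg (ρ : Measure S) (β : ι → ℝ) (θ : ι → S → Real.Angle) (ω : ι → ℝ × ℝ)
    (f : S → ℝ) : ℝ :=
  (∫ φ, f φ * Real.exp (-potential β θ ω φ) ∂ρ) / partitionFn ρ β θ ω

/-- The law of the disorder: all `Jₐ`, `Kₐ` are independent, `Jₐ` is Gaussian with mean `Dₐ` and
variance `σₐ²`, and `Kₐ` is Gaussian with mean `0` and variance `σₐ²`. -/
def disorder (D : ι → ℝ) (σ : ι → ℝ≥0) : Measure (ι → ℝ × ℝ) :=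
  Measure.pi fun a => (gaussianReal (D a) (σ a ^ 2)).prod (gaussianReal 0 (σ a ^ 2))

/-- The quenched pressure `𝔼[log Z]`. -/
def pressure (ρ : Measure S) (β D : ι → ℝ) (σ : ι → ℝ≥0) (θ : ι → S → Real.Angle) : ℝ :=
  ∫ ω, Real.log (partitionFn ρ β θ ω) ∂disorder D σ

end General

/-! ### Two-body model, one-body trial model, single-site mean-field model -/

section Models

variable {Λ : Type*} (Φ : AddSubgroup Real.Angle)

/-- The interaction terms `(⟨ij⟩, m)` of the two-body model: `⟨ij⟩` is a bond, `β_{ij,m} > 0`. -/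
abbrev BondTerm (B : Finset (Λ × Λ)) (β : Λ × Λ → ℤ →₀ ℝ≥0) : Type _ :=
  Σ e : {e // e ∈ B}, {m // m ∈ (β e.1).support}

/-- The interaction terms `(i, m)` of the one-body model: `i` is a site, `β_{i,m} > 0`. -/
abbrev SiteTerm (β₀ : Λ → ℤ →₀ ℝ≥0) : Type _ :=
  Σ i : Λ, {m // m ∈ (β₀ i).support}

/-- The relative phase `m (φ_i - φ_j)`. -/
def pairPhase (e : Λ × Λ) (m : ℤ) (φ : Λ → Φ) : Real.Angle :=
  m • ((φ e.1 : Real.Angle) - (φ e.2 : Real.Angle))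

/-- The phase `m φ_i`. -/
def sitePhase (i : Λ) (m : ℤ) (φ : Λ → Φ) : Real.Angle := m • (φ i : Real.Angle)

variable {Φ}

/-- The partition function `Z` of the two-body model. -/
def bondZ [Fintype Λ] (μ : Measure Φ) (B : Finset (Λ × Λ)) (β : Λ × Λ → ℤ →₀ ℝ≥0)
    (ω : BondTerm B β → ℝ × ℝ) : ℝ :=
  partitionFn (Measure.pi fun _ : Λ => μ) (fun a : BondTerm B β => (β a.1.1 a.2.1 : ℝ))
    (fun a => pairPhase Φ a.1.1 a.2.1) ω

/-- The disorder of the two-body model. -/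
def bondDisorder (B : Finset (Λ × Λ)) (β : Λ × Λ → ℤ →₀ ℝ≥0) (D : Λ × Λ → ℤ → ℝ)
    (σ : Λ × Λ → ℤ → ℝ≥0) : Measure (BondTerm B β → ℝ × ℝ) :=
  disorder (fun a => D a.1.1 a.2.1) (fun a => σ a.1.1 a.2.1)

/-- The partition function `Z₀` of the one-body model. -/
def siteZ [Fintype Λ] (μ : Measure Φ) (β₀ : Λ → ℤ →₀ ℝ≥0) (ω : SiteTerm β₀ → ℝ × ℝ) : ℝ :=
  partitionFn (Measure.pi fun _ : Λ => μ) (fun a : SiteTerm β₀ => (β₀ a.1 a.2.1 : ℝ))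
    (fun a => sitePhase Φ a.1 a.2.1) ω

/-- The thermal average `⟨f⟩₀` of the one-body model. -/
def siteAvg [Fintype Λ] (μ : Measure Φ) (β₀ : Λ → ℤ →₀ ℝ≥0) (ω : SiteTerm β₀ → ℝ × ℝ)
    (f : (Λ → Φ) → ℝ) : ℝ :=
  thermalAvg (Measure.pi fun _ : Λ => μ) (fun a : SiteTerm β₀ => (β₀ a.1 a.2.1 : ℝ))
    (fun a => sitePhase Φ a.1 a.2.1) ω f

/-- The disorder of the one-body model. -/
def siteDisorder [Fintype Λ] (β₀ : Λ → ℤ →₀ ℝ≥0) (D₀ : Λ → ℤ → ℝ) (σ₀ : Λ → ℤ → ℝ≥0) :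
    Measure (SiteTerm β₀ → ℝ × ℝ) :=
  disorder (fun a => D₀ a.1 a.2.1) (fun a => σ₀ a.1 a.2.1)

/-- The quenched pressure of a single spin in the fields
`h_m cos(mφ) + √h_m (J_m cos(mφ) + K_m sin(mφ))`, `J_m`, `K_m` standard Gaussian,
where `m` runs over the finite set `A`. -/
def singleSitePressure (μ : Measure Φ) (A : Finset ℤ) (h : ℤ → ℝ≥0) : ℝ :=
  pressure μ (fun _ : {m // m ∈ A} => 1) (fun m => (h m.1 : ℝ)) (fun m => NNReal.sqrt (h m.1))
    (fun m (φ : Φ) => m.1 • (φ : Real.Angle))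

/-- The replica-symmetric mean-field free energy per site (times the inverse temperature) on the
Nishimori line, with coordination number `z`, coupling parameters `x_m` and order parameters
`M_m`, where the magnetization and the overlap of two replicas are both equal to `M_m`. -/
def rsFreeEnergy (μ : Measure Φ) (z : ℕ) (x : ℤ →₀ ℝ≥0) (M : ℤ → ℝ≥0) : ℝ :=
  -(singleSitePressure μ x.support (fun m => z * x m * M m)
    + (z : ℝ) / 4 * ∑ m ∈ x.support, (x m : ℝ) * (1 - 2 * (M m : ℝ) - (M m : ℝ) ^ 2))

end Models

end

end GaugeGlass

/-! The disorder is read as the output of a Gaussian channel. With noise `ω` and amplitudes `s =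
βσ`, let `W` be the integral over configurations of the likelihood ratio `gWeight` of the signals `s
cos θ`, `s sin θ` against pure noise. Because `cos² + sin² = 1`, the quadratic correction in the
likelihood is a constant, so `W` is the partition function up to an explicit factor
(`gWeight_circ`).

On the Nishimori line the mean of the disorder is exactly the signal emitted by the configuration
`0` (`potential_nishimori`). Rotating each Gaussian pair and translating the invariant measure moves
any other planted configuration to `0`. Hence the expectation of a gauge-invariant quantity over the
planted disorder is, up to the total mass of the a priori measure, its expectation over pure noise
weighted with `W` (`integral_gWeight_mul_eq_planted`). In particular `𝔼[log Z]` becomes the sum of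
`s²/2` plus the normalized entropy `𝔼[W log W]`.

This entropy is convex in the squared amplitudes. Gaussian integration by parts gives the gradient
`½ 𝔼[W⟨c_k⟩²]`, and once more a Hessian that is a positive multiple of `𝔼[W Cov(c_j, c_k)²]`. A
matrix of squared covariances is positive semidefinite, as two independent replicas show
(`sum_mul_sq_integral_nonneg`). So the entropy lies above its tangents (`entropy_tangent_le`).

Both models are placed in one system carrying all the interaction terms. The tangent is taken at the
point where only the one-body terms are active and evaluated where only the two-body terms are
active. By the Nishimori identity `𝔼[⟨cos⟩² + ⟨sin⟩²] = 𝔼[⟨cos⟩]` the gradient turns into the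
averages of the theorem (`integral_overlap_eq_planted`, `gibbs_bogoliubov`).

For the replica-symmetric bound the trial fields are `h_m = z x_m M_m` at every site. Sites are then
independent, so a bond average is at least `q_m²`, where `q_m` is the single-site average of the
cosine. What remains is the nonnegative square `(q_m - M_m)²`. -/

namespace GaugeGlass

noncomputable section

set_option linter.unusedSectionVars false

/-! ### Standard Gaussian vectors -/

section GaussianVector

variable {κ : Type*} [Fintype κ]

/-- The standard Gaussian measure on `κ → ℝ`. -/
def stdGaussianPi (κ : Type*) [Fintype κ] : Measure (κ → ℝ) :=
  Measure.pi fun _ => gaussianReal 0 1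

instance : IsProbabilityMeasure (stdGaussianPi κ) := by
  unfold stdGaussianPi; infer_instance

/-- The `ℓ¹`-norm. -/
def absSum (ω : κ → ℝ) : ℝ := ∑ k, |ω k|

lemma absSum_nonneg (ω : κ → ℝ) : 0 ≤ absSum ω := Finset.sum_nonneg fun _ _ => abs_nonneg _

lemma abs_le_absSum (ω : κ → ℝ) (k : κ) : |ω k| ≤ absSum ω :=
  Finset.single_le_sum (f := fun k => |ω k|) (fun _ _ => abs_nonneg _) (Finset.mem_univ k)

lemma absSum_add_le (ω v : κ → ℝ) : absSum (ω + v) ≤ absSum ω + absSum v := by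
  unfold absSum
  rw [← Finset.sum_add_distrib]
  exact Finset.sum_le_sum fun k _ => abs_add_le _ _

lemma absSum_single [DecidableEq κ] (k : κ) (ε : ℝ) : absSum (Pi.single k ε) = |ε| := by
  unfold absSum
  rw [Finset.sum_eq_single k]
  · simp
  · intro j _ hj; simp [hj]
  · simp

lemma integrable_exp_absSum (c : ℝ) :
    Integrable (fun ω => Real.exp (c * absSum ω)) (stdGaussianPi κ) := by
  have h1 : ∀ _k : κ, Integrable (fun x : ℝ => Real.exp (c * |x|)) (gaussianReal 0 1) := fun _ =>
    integrable_exp_mul_abs (integrable_exp_mul_gaussianReal c) (integrable_exp_mul_gaussianReal (-c))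
  have h2 := Integrable.fintype_prod (μ := fun _ : κ => gaussianReal 0 1) h1
  refine h2.congr (ae_of_all _ fun ω => ?_)
  simp only [absSum, Finset.mul_sum, Real.exp_sum]

/-- A family of functions has uniformly at most exponential growth. -/
def ExpBounded {T : Type*} (g : T → (κ → ℝ) → ℝ) : Prop :=
  ∃ C c : ℝ, 0 ≤ C ∧ 0 ≤ c ∧ ∀ t ω, |g t ω| ≤ C * Real.exp (c * absSum ω)

namespace ExpBounded

variable {T : Type*} {f g : T → (κ → ℝ) → ℝ}

lemma mono (hg : ExpBounded g) (h : ∀ t ω, |f t ω| ≤ |g t ω|) : ExpBounded f := by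
  obtain ⟨C, c, hC, hc, hb⟩ := hg
  exact ⟨C, c, hC, hc, fun t ω => (h t ω).trans (hb t ω)⟩

lemma const (C : ℝ) : ExpBounded (fun (_ : T) (_ : κ → ℝ) => C) :=
  ⟨|C|, 0, abs_nonneg _, le_rfl, fun _ _ => by simp⟩

lemma of_bounded {u : T → ℝ} {K : ℝ} (h : ∀ t, |u t| ≤ K) :
    ExpBounded (fun (t : T) (_ : κ → ℝ) => u t) := by
  refine ⟨|K|, 0, abs_nonneg _, le_rfl, fun t _ => ?_⟩
  simpa using (h t).trans (le_abs_self K)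

lemma coord (k : κ) : ExpBounded (fun (_ : T) (ω : κ → ℝ) => ω k) := by
  refine ⟨1, 1, zero_le_one, zero_le_one, fun _ ω => ?_⟩
  have := Real.add_one_le_exp (absSum ω)
  have := abs_le_absSum ω k
  simp only [one_mul]; linarith

lemma add (hf : ExpBounded f) (hg : ExpBounded g) : ExpBounded (fun t ω => f t ω + g t ω) := by
  obtain ⟨C, c, hC, hc, hb⟩ := hf
  obtain ⟨C', c', hC', hc', hb'⟩ := hg
  refine ⟨C + C', c + c', by positivity, by positivity, fun t ω => ?_⟩
  have h0 := absSum_nonneg ω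
  calc |f t ω + g t ω| ≤ |f t ω| + |g t ω| := abs_add_le _ _
    _ ≤ C * Real.exp (c * absSum ω) + C' * Real.exp (c' * absSum ω) := add_le_add (hb t ω) (hb' t ω)
    _ ≤ C * Real.exp ((c + c') * absSum ω) + C' * Real.exp ((c + c') * absSum ω) := by
        gcongr <;> linarith
    _ = _ := by ring

lemma mul (hf : ExpBounded f) (hg : ExpBounded g) : ExpBounded (fun t ω => f t ω * g t ω) := by
  obtain ⟨C, c, hC, hc, hb⟩ := hf
  obtain ⟨C', c', hC', hc', hb'⟩ := hg
  refine ⟨C * C', c + c', by positivity, by positivity, fun t ω => ?_⟩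
  rw [abs_mul, add_mul, Real.exp_add]
  calc |f t ω| * |g t ω|
      ≤ (C * Real.exp (c * absSum ω)) * (C' * Real.exp (c' * absSum ω)) :=
        mul_le_mul (hb t ω) (hb' t ω) (abs_nonneg _) (by positivity)
    _ = _ := by ring

lemma neg (hf : ExpBounded f) : ExpBounded (fun t ω => -f t ω) :=
  hf.mono fun t ω => by simp

lemma sub (hf : ExpBounded f) (hg : ExpBounded g) : ExpBounded (fun t ω => f t ω - g t ω) := by
  simpa only [sub_eq_add_neg] using hf.add hg.neg

lemma pow (hf : ExpBounded f) (n : ℕ) : ExpBounded (fun t ω => f t ω ^ n) := by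
  induction n with
  | zero => simpa using const 1
  | succ n ih => simpa only [pow_succ] using ih.mul hf

lemma sum {J : Type*} (s : Finset J) {F : J → T → (κ → ℝ) → ℝ} (h : ∀ j ∈ s, ExpBounded (F j)) :
    ExpBounded (fun t ω => ∑ j ∈ s, F j t ω) := by
  classical
  induction s using Finset.induction_on with
  | empty => simpa using const 0
  | insert j s hj ih =>
    simp only [Finset.sum_insert hj]
    exact (h j (Finset.mem_insert_self j s)).add
      (ih fun i hi => h i (Finset.mem_insert_of_mem hi))

lemma integrable (hf : ExpBounded f) (t : T) (hm : Measurable (f t)) :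
    Integrable (f t) (stdGaussianPi κ) := by
  obtain ⟨C, c, hC, hc, hb⟩ := hf
  exact ((integrable_exp_absSum c).const_mul C).mono' hm.aestronglyMeasurable
    (ae_of_all _ fun ω => hb t ω)

end ExpBounded

/-! ### Shifts of a Gaussian vector and integration by parts. -/

lemma gaussianReal_one_eq_withDensity (m : ℝ) :
    gaussianReal m 1 =
      (gaussianReal 0 1).withDensity fun x => ENNReal.ofReal (Real.exp (m * x - m ^ 2 / 2)) := by
  rw [gaussianReal_of_var_ne_zero _ one_ne_zero, gaussianReal_of_var_ne_zero _ one_ne_zero,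
    ← withDensity_mul _ (measurable_gaussianPDF _ _) (by fun_prop)]
  congr 1
  ext x
  simp only [gaussianPDF, Pi.mul_apply, gaussianPDFReal]
  rw [← ENNReal.ofReal_mul (by positivity)]
  rw [mul_assoc _ (Real.exp _), ← Real.exp_add]
  congr 3
  simp only [NNReal.coe_one]
  ring

/-- A product measure is determined by its values on boxes. There the exponential and the indicator
both factor over the coordinates, leaving the one-dimensional density ratio. -/
lemma pi_gaussianReal_eq_withDensity (v : κ → ℝ) :
    Measure.pi (fun k => gaussianReal (v k) 1) = (stdGaussianPi κ).withDensity
      fun ω => ENNReal.ofReal (Real.exp (∑ k, (v k * ω k - v k ^ 2 / 2))) := by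
  refine Measure.pi_eq (μ := fun k => gaussianReal (v k) 1) fun s hs => ?_
  have h1 : ∀ k, Integrable ((s k).indicator fun x => Real.exp (v k * x - v k ^ 2 / 2))
      (gaussianReal 0 1) := fun k => by
    refine Integrable.indicator ?_ (hs k)
    simp only [sub_eq_add_neg, Real.exp_add]
    exact (integrable_exp_mul_gaussianReal (v k)).mul_const _
  have hind : ∀ ω : κ → ℝ, (Set.univ.pi s).indicator
      (fun ω => Real.exp (∑ k, (v k * ω k - v k ^ 2 / 2))) ω
      = ∏ k, (s k).indicator (fun x => Real.exp (v k * x - v k ^ 2 / 2)) (ω k) := by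
    intro ω
    by_cases h : ω ∈ Set.univ.pi s
    · rw [Set.indicator_of_mem h, Real.exp_sum]
      refine Finset.prod_congr rfl fun k _ => ?_
      rw [Set.indicator_of_mem (h k (Set.mem_univ k))]
    · rw [Set.indicator_of_notMem h]
      simp only [Set.mem_pi, Set.mem_univ, true_imp_iff, not_forall] at h
      obtain ⟨k, hk⟩ := h
      exact (Finset.prod_eq_zero (Finset.mem_univ k) (Set.indicator_of_notMem hk _)).symm
  have hsm : MeasurableSet (Set.univ.pi s) := MeasurableSet.univ_pi hs
  have hint : Integrable ((Set.univ.pi s).indicator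
      (fun ω : κ → ℝ => Real.exp (∑ k, (v k * ω k - v k ^ 2 / 2)))) (stdGaussianPi κ) := by
    rw [funext hind]
    exact Integrable.fintype_prod_dep (μ := fun _ : κ => gaussianReal 0 1) h1
  rw [withDensity_apply _ hsm, ← ofReal_integral_eq_lintegral_ofReal
    ((integrable_indicator_iff hsm).1 hint) (ae_of_all _ fun _ => (Real.exp_pos _).le),
    ← integral_indicator hsm, funext hind, stdGaussianPi,
    integral_fintype_prod_eq_prod (μ := fun _ : κ => gaussianReal 0 1)
      (fun k => (s k).indicator fun x => Real.exp (v k * x - v k ^ 2 / 2)),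
    ENNReal.ofReal_prod_of_nonneg
      fun k _ => integral_nonneg fun x => Set.indicator_nonneg (fun _ _ => (Real.exp_pos _).le) x]
  refine Finset.prod_congr rfl fun k _ => ?_
  rw [gaussianReal_one_eq_withDensity (v k), withDensity_apply _ (hs k),
    ← ofReal_integral_eq_lintegral_ofReal ((integrable_indicator_iff (hs k)).1 (h1 k))
      (ae_of_all _ fun _ => (Real.exp_pos _).le), ← integral_indicator (hs k)]

lemma measurePreserving_add_stdGaussianPi (v : κ → ℝ) :
    MeasurePreserving (fun ω => ω + v) (stdGaussianPi κ)
      (Measure.pi fun k => gaussianReal (v k) 1) := by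
  refine measurePreserving_pi (fun _ : κ => gaussianReal 0 1) (fun k => gaussianReal (v k) 1)
    (f := fun k x => x + v k) fun k => ⟨by fun_prop, ?_⟩
  rw [gaussianReal_map_add_const, zero_add]

/-- The Cameron-Martin formula. -/
lemma integral_add_stdGaussianPi (v : κ → ℝ) (h : (κ → ℝ) → ℝ) :
    ∫ ω, h (ω + v) ∂stdGaussianPi κ
      = ∫ ω, Real.exp (∑ k, (v k * ω k - v k ^ 2 / 2)) * h ω ∂stdGaussianPi κ := by
  have he : MeasurableEmbedding (fun ω : κ → ℝ => ω + v) :=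
    (MeasurableEquiv.addRight v).measurableEmbedding
  rw [(measurePreserving_add_stdGaussianPi v).integral_comp he, pi_gaussianReal_eq_withDensity,
    integral_withDensity_eq_integral_toReal_smul (by fun_prop)
      (ae_of_all _ fun _ => ENNReal.ofReal_lt_top)]
  refine integral_congr_ae (ae_of_all _ fun ω => ?_)
  simp only [smul_eq_mul, ENNReal.toReal_ofReal (Real.exp_pos _).le]

/-- Gaussian integration by parts. -/
lemma integral_coord_mul_stdGaussianPi [DecidableEq κ] {T : Type*} (k : κ)
    {h h' : T → (κ → ℝ) → ℝ} (t : T)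
    (hd : ∀ ω, HasDerivAt (fun ε : ℝ => h t (ω + Pi.single k ε)) (h' t ω) 0)
    (hm : Measurable (h t)) (hm' : Measurable (h' t)) (hb : ExpBounded h) (hb' : ExpBounded h') :
    ∫ ω, ω k * h t ω ∂stdGaussianPi κ = ∫ ω, h' t ω ∂stdGaussianPi κ := by
  -- The derivative at `0` is assumed at every base point, so moving the base point gives it at
  -- every `ε`.
  have hd' : ∀ (ω : κ → ℝ) (ε : ℝ), HasDerivAt (fun ε : ℝ => h t (ω + Pi.single k ε))
      (h' t (ω + Pi.single k ε)) ε := by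
    intro ω ε
    have h1 := hd (ω + Pi.single k ε)
    have h2 : HasDerivAt (fun x => x - ε) 1 ε := (hasDerivAt_id ε).sub_const ε
    have h3 := HasDerivAt.comp ε (h₂ := fun δ : ℝ => h t (ω + Pi.single k ε + Pi.single k δ))
      (h := fun x => x - ε) (by simpa using h1) h2
    simp only [Function.comp_def, add_assoc, ← Pi.single_add, add_sub_cancel, mul_one] at h3
    exact h3
  obtain ⟨C, c, hC, hc, hB⟩ := hb
  obtain ⟨C', c', hC', hc', hB'⟩ := hb'
  have hsingle : ∀ ε : ℝ, Measurable fun ω : κ → ℝ => ω + Pi.single k ε := fun ε => by fun_prop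
  -- The Cameron-Martin identity for the shift by `ε` along the coordinate `k` is differentiated at
  -- `ε = 0` on both sides: this side yields the expectation of `h'`, the side `hR` that of `ω k *
  -- h`.
  have hL : HasDerivAt (fun ε : ℝ => ∫ ω, h t (ω + Pi.single k ε) ∂stdGaussianPi κ)
      (∫ ω, h' t (ω + Pi.single k 0) ∂stdGaussianPi κ) 0 := by
    refine (hasDerivAt_integral_of_dominated_loc_of_deriv_le
      (F := fun (ε : ℝ) ω => h t (ω + Pi.single k ε)) (F' := fun (ε : ℝ) ω => h' t (ω + Pi.single k ε))
      (bound := fun ω => C' * Real.exp c' * Real.exp (c' * absSum ω))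
      (Metric.ball_mem_nhds (0 : ℝ) one_pos)
      (Filter.Eventually.of_forall fun ε => (hm.comp (hsingle ε)).aestronglyMeasurable) ?_
      (hm'.comp (hsingle 0)).aestronglyMeasurable ?_ ((integrable_exp_absSum c').const_mul _)
      (ae_of_all _ fun ω ε _ => hd' ω ε)).2
    · simp only [Pi.single_zero, add_zero]
      exact ((integrable_exp_absSum c).const_mul C).mono' hm.aestronglyMeasurable
        (ae_of_all _ fun ω => hB t ω)
    · refine ae_of_all _ fun ω ε hε => (hB' t _).trans ?_
      rw [mul_assoc, ← Real.exp_add]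
      have h1 : absSum (ω + Pi.single k ε) ≤ absSum ω + 1 := by
        refine (absSum_add_le _ _).trans ?_
        rw [absSum_single]
        have : |ε| < 1 := by simpa using hε
        linarith
      gcongr
      nlinarith
  have hR : HasDerivAt (fun ε => ∫ ω, Real.exp (ε * ω k - ε ^ 2 / 2) * h t ω ∂stdGaussianPi κ)
      (∫ ω, (ω k - 0) * Real.exp (0 * ω k - 0 ^ 2 / 2) * h t ω ∂stdGaussianPi κ) 0 := by
    refine (hasDerivAt_integral_of_dominated_loc_of_deriv_le
      (F := fun ε ω => Real.exp (ε * ω k - ε ^ 2 / 2) * h t ω)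
      (F' := fun ε ω => (ω k - ε) * Real.exp (ε * ω k - ε ^ 2 / 2) * h t ω)
      -- One extra unit in the rate absorbs the factor `ω k - ε`, the other the exponential density,
      -- both for `|ε| < 1`.
      (bound := fun ω => C * Real.exp ((c + 2) * absSum ω))
      (Metric.ball_mem_nhds (0 : ℝ) one_pos)
      (Filter.Eventually.of_forall fun ε => ?_) ?_
      ?_ ?_ ((integrable_exp_absSum _).const_mul _)
      (ae_of_all _ fun ω ε _ => ?_)).2
    · exact Measurable.aestronglyMeasurable (by fun_prop)
    · simp only [zero_mul, ne_eq, OfNat.ofNat_ne_zero, not_false_eq_true, zero_pow, zero_div,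
        sub_zero, Real.exp_zero, one_mul]
      exact ((integrable_exp_absSum c).const_mul C).mono' hm.aestronglyMeasurable
        (ae_of_all _ fun ω => hB t ω)
    · exact Measurable.aestronglyMeasurable (by fun_prop)
    · refine ae_of_all _ fun ω ε hε => ?_
      have h1 : |ε| < 1 := by simpa using hε
      have h2 := abs_le_absSum ω k
      have h3 : |ω k - ε| ≤ Real.exp (absSum ω) :=
        (abs_sub _ _).trans (by have := Real.add_one_le_exp (absSum ω); linarith)
      have h4 : Real.exp (ε * ω k - ε ^ 2 / 2) ≤ Real.exp (absSum ω) := by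
        apply Real.exp_le_exp.2
        have : ε * ω k ≤ |ε| * |ω k| := by rw [← abs_mul]; exact le_abs_self _
        have : |ε| * |ω k| ≤ 1 * |ω k| := by gcongr
        nlinarith [sq_nonneg ε]
      rw [Real.norm_eq_abs, abs_mul, abs_mul, Real.abs_exp]
      calc |ω k - ε| * Real.exp (ε * ω k - ε ^ 2 / 2) * |h t ω|
          ≤ Real.exp (absSum ω) * Real.exp (absSum ω) * (C * Real.exp (c * absSum ω)) := by
            gcongr; exact hB t ω
        _ = _ := by
            rw [show (c + 2) * absSum ω = absSum ω + absSum ω + c * absSum ω by ring,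
              Real.exp_add, Real.exp_add]; ring
    · have h1 : HasDerivAt (fun ε : ℝ => ε * ω k - ε ^ 2 / 2) (ω k - ε) ε := by
        have := ((hasDerivAt_id ε).mul_const (ω k)).sub (((hasDerivAt_id ε).pow 2).div_const 2)
        refine this.congr_deriv ?_
        simp
      refine (h1.exp.mul_const (h t ω)).congr_deriv ?_
      ring
  have hLR : (fun ε : ℝ => ∫ ω, h t (ω + Pi.single k ε) ∂stdGaussianPi κ)
      = fun ε => ∫ ω, Real.exp (ε * ω k - ε ^ 2 / 2) * h t ω ∂stdGaussianPi κ := by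
    funext ε
    rw [integral_add_stdGaussianPi]
    refine integral_congr_ae (ae_of_all _ fun ω => ?_)
    simp only
    rw [Finset.sum_eq_single k]
    · simp
    · intro j _ hj; simp [hj]
    · simp
  rw [hLR] at hL
  have := hR.unique hL
  simpa using this

end GaussianVector

/-! ### Likelihoods of a Gaussian channel

The weight `exp (∑ₖ (sₖ ωₖ cₖ(φ) - sₖ² cₖ(φ)² / 2))` is the likelihood ratio of the observations
`ω = (sₖ cₖ(φ) + noise)ₖ` with respect to pure noise. -/

section GaussianChannel

variable {κ S : Type*} [Fintype κ] [MeasurableSpace S]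

/-- The likelihood ratio of the Gaussian channel with amplitudes `s`. -/
def gWeight (c : κ → S → ℝ) (s ω : κ → ℝ) (φ : S) : ℝ :=
  Real.exp (∑ k, (s k * ω k * c k φ - s k ^ 2 * c k φ ^ 2 / 2))

/-- The integral of `f` against the unnormalized posterior. -/
def gInt (ρ : Measure S) (c : κ → S → ℝ) (s : κ → ℝ) (f : S → ℝ) (ω : κ → ℝ) : ℝ :=
  ∫ φ, f φ * gWeight c s ω φ ∂ρ

/-- Bounded measurable functions. -/
structure BddMeas (f : S → ℝ) : Prop where
  measurable : Measurable f
  bdd : ∃ K, ∀ φ, |f φ| ≤ K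

namespace BddMeas

variable {f g : S → ℝ}

lemma const (r : ℝ) : BddMeas (fun _ : S => r) := ⟨measurable_const, |r|, fun _ => le_rfl⟩

lemma mul (hf : BddMeas f) (hg : BddMeas g) : BddMeas (fun φ => f φ * g φ) := by
  obtain ⟨hf, K, hK⟩ := hf
  obtain ⟨hg, L, hL⟩ := hg
  refine ⟨hf.mul hg, K * L, fun φ => ?_⟩
  rw [abs_mul]
  exact mul_le_mul (hK φ) (hL φ) (abs_nonneg _) ((abs_nonneg _).trans (hK φ))

lemma add (hf : BddMeas f) (hg : BddMeas g) : BddMeas (fun φ => f φ + g φ) := by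
  obtain ⟨hf, K, hK⟩ := hf
  obtain ⟨hg, L, hL⟩ := hg
  exact ⟨hf.add hg, K + L, fun φ => (abs_add_le _ _).trans (add_le_add (hK φ) (hL φ))⟩

lemma sub (hf : BddMeas f) (hg : BddMeas g) : BddMeas (fun φ => f φ - g φ) := by
  simpa only [sub_eq_add_neg, neg_mul, one_mul] using hf.add ((const (-1)).mul hg)

lemma pow (hf : BddMeas f) (n : ℕ) : BddMeas (fun φ => f φ ^ n) := by
  induction n with
  | zero => simpa using const 1
  | succ n ih => simpa only [pow_succ] using ih.mul hf

lemma sum {J : Type*} (s : Finset J) {F : J → S → ℝ} (h : ∀ j ∈ s, BddMeas (F j)) :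
    BddMeas (fun φ => ∑ j ∈ s, F j φ) := by
  classical
  induction s using Finset.induction_on with
  | empty => simpa using const 0
  | insert j s hj ih =>
    simp only [Finset.sum_insert hj]
    exact (h j (Finset.mem_insert_self j s)).add
      (ih fun i hi => h i (Finset.mem_insert_of_mem hi))

lemma exp (hf : BddMeas f) : BddMeas (fun φ => Real.exp (f φ)) := by
  obtain ⟨hf, K, hK⟩ := hf
  refine ⟨hf.exp, Real.exp K, fun φ => ?_⟩
  rw [Real.abs_exp]
  exact Real.exp_le_exp.2 ((le_abs_self _).trans (hK φ))

lemma integrable (hf : BddMeas f) (ρ : Measure S) [IsFiniteMeasure ρ] : Integrable f ρ := by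
  obtain ⟨hf, K, hK⟩ := hf
  exact Integrable.of_bound hf.aestronglyMeasurable K (ae_of_all _ hK)

end BddMeas

/-- Differentiation of an exponential integral along a curve of exponents. -/
lemma hasDerivAt_integral_mul_exp (ρ : Measure S) [IsFiniteMeasure ρ] {f : S → ℝ}
    (hf : BddMeas f) {l l' : ℝ → S → ℝ} {K : ℝ} (ε : ℝ) (hl : ∀ ε, Measurable (l ε))
    (hl' : ∀ ε, Measurable (l' ε)) (hd : ∀ ε φ, HasDerivAt (fun ε => l ε φ) (l' ε φ) ε)
    (hb : ∀ φ, |l ε φ| ≤ K) (hb' : ∀ ε φ, |l' ε φ| ≤ K) :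
    HasDerivAt (fun ε => ∫ φ, f φ * Real.exp (l ε φ) ∂ρ)
      (∫ φ, f φ * (l' ε φ * Real.exp (l ε φ)) ∂ρ) ε := by
  obtain ⟨hfm, M, hM⟩ := hf
  -- The factor `2` is one bound for the exponent at `ε` plus one for its variation over a distance
  -- at most `1`, by the mean value inequality.
  have hlip : ∀ φ, ∀ δ ∈ Metric.ball ε 1, |l δ φ| ≤ 2 * |K| := by
    intro φ δ hδ
    have h1 := (convex_univ (𝕜 := ℝ) (E := ℝ)).norm_image_sub_le_of_norm_hasDerivWithin_le
      (f := fun ε => l ε φ) (f' := fun ε => l' ε φ) (C := K)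
      (fun x _ => (hd x φ).hasDerivWithinAt) (fun x _ => hb' x φ) (Set.mem_univ ε) (Set.mem_univ δ)
    have h2 : |δ - ε| ≤ 1 := by
      have : |δ - ε| < 1 := by simpa [Real.dist_eq] using hδ
      exact this.le
    have h0 : 0 ≤ K := (abs_nonneg _).trans (hb φ)
    have h3 : |l δ φ - l ε φ| ≤ K * |δ - ε| := h1
    have h4 : |l δ φ| ≤ |l δ φ - l ε φ| + |l ε φ| := by
      have := abs_add_le (l δ φ - l ε φ) (l ε φ); simpa using this
    rw [abs_of_nonneg h0]
    nlinarith [hb φ]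
  have hexp : ∀ φ, ∀ δ ∈ Metric.ball ε 1, Real.exp (l δ φ) ≤ Real.exp (2 * |K|) := fun φ δ hδ =>
    Real.exp_le_exp.2 ((le_abs_self _).trans (hlip φ δ hδ))
  refine (hasDerivAt_integral_of_dominated_loc_of_deriv_le
    (F := fun ε φ => f φ * Real.exp (l ε φ))
    (F' := fun ε φ => f φ * (l' ε φ * Real.exp (l ε φ)))
    (bound := fun _ => |M| * (|K| * Real.exp (2 * |K|)))
    (Metric.ball_mem_nhds ε one_pos)
    (Filter.Eventually.of_forall fun δ => (hfm.mul (hl δ).exp).aestronglyMeasurable) ?_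
    (hfm.mul ((hl' ε).mul (hl ε).exp)).aestronglyMeasurable ?_ (integrable_const _)
    (ae_of_all _ fun φ δ _ => ((hd δ φ).exp.const_mul (f φ)).congr_deriv (by ring))).2
  · refine Integrable.of_bound (hfm.mul (hl ε).exp).aestronglyMeasurable
      (|M| * Real.exp (2 * |K|)) (ae_of_all _ fun φ => ?_)
    rw [Real.norm_eq_abs, abs_mul, Real.abs_exp]
    exact mul_le_mul ((hM φ).trans (le_abs_self M)) (hexp φ ε (Metric.mem_ball_self one_pos))
      (Real.exp_pos _).le (abs_nonneg _)
  · refine ae_of_all _ fun φ δ hδ => ?_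
    rw [Real.norm_eq_abs, abs_mul, abs_mul, Real.abs_exp]
    exact mul_le_mul ((hM φ).trans (le_abs_self M))
      (mul_le_mul ((hb' δ φ).trans (le_abs_self K)) (hexp φ δ hδ) (Real.exp_pos _).le
        (abs_nonneg _)) (by positivity) (abs_nonneg _)

variable {c : κ → S → ℝ}

lemma gWeight_pos (c : κ → S → ℝ) (s ω : κ → ℝ) (φ : S) : 0 < gWeight c s ω φ := Real.exp_pos _

lemma bddMeas_exponent (hc : ∀ k, BddMeas (c k)) (s ω : κ → ℝ) :
    BddMeas fun φ => ∑ k, (s k * ω k * c k φ - s k ^ 2 * c k φ ^ 2 / 2) :=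
  BddMeas.sum _ fun k _ => by
    have := ((BddMeas.const (s k * ω k)).mul (hc k)).sub
      ((BddMeas.const (s k ^ 2 / 2)).mul ((hc k).pow 2))
    convert this using 3
    ring

lemma bddMeas_gWeight (hc : ∀ k, BddMeas (c k)) (s ω : κ → ℝ) : BddMeas (gWeight c s ω) :=
  (bddMeas_exponent hc s ω).exp

lemma measurable_gWeight_uncurry (hc : ∀ k, Measurable (c k)) (s : κ → ℝ) :
    Measurable fun p : (κ → ℝ) × S => gWeight c s p.1 p.2 := by
  unfold gWeight
  refine (Finset.measurable_sum _ fun k _ => ?_).exp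
  have : Measurable fun p : (κ → ℝ) × S => c k p.2 := (hc k).comp measurable_snd
  fun_prop

variable (ρ : Measure S) [IsFiniteMeasure ρ]

lemma integrable_mul_gWeight (hc : ∀ k, BddMeas (c k)) (s ω : κ → ℝ) {f : S → ℝ}
    (hf : BddMeas f) : Integrable (fun φ => f φ * gWeight c s ω φ) ρ :=
  (hf.mul (bddMeas_gWeight hc s ω)).integrable ρ

lemma measurable_gInt (hc : ∀ k, BddMeas (c k)) (s : κ → ℝ) {f : S → ℝ} (hf : BddMeas f) :
    Measurable (gInt ρ c s f) := by
  have h : Measurable fun p : (κ → ℝ) × S => f p.2 * gWeight c s p.1 p.2 :=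
    (hf.measurable.comp measurable_snd).mul
      (measurable_gWeight_uncurry (fun k => (hc k).measurable) s)
  exact (h.stronglyMeasurable.integral_prod_right' (ν := ρ)).measurable

lemma gInt_one_pos [NeZero ρ] (hc : ∀ k, BddMeas (c k)) (s ω : κ → ℝ) :
    0 < gInt ρ c s (fun _ => 1) ω := by
  unfold gInt
  simp only [one_mul]
  exact integral_exp_pos ((bddMeas_gWeight hc s ω).integrable ρ)

lemma abs_gInt_le (hc : ∀ k, BddMeas (c k)) (s ω : κ → ℝ) {f : S → ℝ} {K : ℝ}
    (hK : ∀ φ, |f φ| ≤ K) : |gInt ρ c s f ω| ≤ K * gInt ρ c s (fun _ => 1) ω := by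
  unfold gInt
  rw [← integral_const_mul, ← Real.norm_eq_abs]
  refine norm_integral_le_of_norm_le
    ((integrable_mul_gWeight ρ hc s ω (BddMeas.const 1)).const_mul K) (ae_of_all _ fun φ => ?_)
  rw [Real.norm_eq_abs, abs_mul, abs_of_pos (gWeight_pos c s ω φ), one_mul]
  exact mul_le_mul_of_nonneg_right (hK φ) (gWeight_pos c s ω φ).le

lemma abs_exponent_le {s : κ → ℝ} {R : ℝ} (hs : ∀ k, |s k| ≤ R) (hc1 : ∀ k φ, |c k φ| ≤ 1)
    (ω : κ → ℝ) (φ : S) :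
    |∑ k, (s k * ω k * c k φ - s k ^ 2 * c k φ ^ 2 / 2)|
      ≤ R * absSum ω + Fintype.card κ * (R ^ 2 / 2) := by
  have h : ∀ k, |s k * ω k * c k φ - s k ^ 2 * c k φ ^ 2 / 2| ≤ R * |ω k| + R ^ 2 / 2 := by
    intro k
    have hR : 0 ≤ R := (abs_nonneg _).trans (hs k)
    refine (abs_sub _ _).trans (add_le_add ?_ ?_)
    · rw [abs_mul, abs_mul]
      calc |s k| * |ω k| * |c k φ| ≤ R * |ω k| * 1 := by gcongr; exacts [hs k, hc1 k φ]
        _ = _ := mul_one _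
    · rw [abs_div, abs_mul, abs_pow, abs_pow, abs_two]
      have h1 : |s k| ^ 2 * |c k φ| ^ 2 ≤ R ^ 2 * 1 ^ 2 := by gcongr; exacts [hs k, hc1 k φ]
      linarith
  refine (Finset.abs_sum_le_sum_abs _ _).trans ((Finset.sum_le_sum fun k _ => h k).trans ?_)
  simp [Finset.sum_add_distrib, absSum, Finset.mul_sum]

/-! ### Exponential growth bounds, uniform over bounded families of amplitudes. -/

section Growth

variable {T : Type*} {s : T → κ → ℝ} {R : ℝ}

lemma expBounded_gInt_one (hs : ∀ t k, |s t k| ≤ R) (hc1 : ∀ k φ, |c k φ| ≤ 1) :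
    ExpBounded fun t => gInt ρ c (s t) fun _ => 1 := by
  refine ⟨ρ.real Set.univ * Real.exp (Fintype.card κ * (R ^ 2 / 2)), |R|, by positivity,
    abs_nonneg _, fun t ω => ?_⟩
  have h : ∀ φ, ‖1 * gWeight c (s t) ω φ‖
      ≤ Real.exp (Fintype.card κ * (R ^ 2 / 2)) * Real.exp (|R| * absSum ω) := by
    intro φ
    rw [one_mul, Real.norm_eq_abs, abs_of_pos (gWeight_pos _ _ _ _), ← Real.exp_add]
    apply Real.exp_le_exp.2
    have h1 := (le_abs_self _).trans (abs_exponent_le (hs t) hc1 ω φ)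
    have h2 := mul_le_mul_of_nonneg_right (le_abs_self R) (absSum_nonneg ω)
    linarith
  have := norm_integral_le_of_norm_le_const (μ := ρ) (ae_of_all _ h)
  rw [Real.norm_eq_abs] at this
  exact this.trans (le_of_eq (by ring))

lemma expBounded_gInt (hs : ∀ t k, |s t k| ≤ R) (hc : ∀ k, BddMeas (c k))
    (hc1 : ∀ k φ, |c k φ| ≤ 1) {f : S → ℝ} (hf : BddMeas f) :
    ExpBounded fun t => gInt ρ c (s t) f := by
  obtain ⟨-, K, hK⟩ := hf
  refine ((ExpBounded.const K).mul (expBounded_gInt_one ρ hs hc1)).mono fun t ω => ?_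
  exact (abs_gInt_le ρ hc (s t) ω hK).trans (le_abs_self _)

/-- The exponent is bounded uniformly in the configuration, so the weight has a positive lower bound
depending only on `absSum ω`; integrating it and inverting gives the growth rate. -/
lemma expBounded_inv_gInt_one [NeZero ρ] (hs : ∀ t k, |s t k| ≤ R) (hc : ∀ k, BddMeas (c k))
    (hc1 : ∀ k φ, |c k φ| ≤ 1) : ExpBounded fun t ω => (gInt ρ c (s t) (fun _ => 1) ω)⁻¹ := by
  refine ⟨(ρ.real Set.univ)⁻¹ * Real.exp (Fintype.card κ * (R ^ 2 / 2)), |R|, by positivity,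
    abs_nonneg _, fun t ω => ?_⟩
  have hρ : 0 < ρ.real Set.univ := by
    rw [measureReal_def]
    exact ENNReal.toReal_pos (by simpa using NeZero.ne ρ) (measure_ne_top _ _)
  have h : ∀ φ, Real.exp (-(Fintype.card κ * (R ^ 2 / 2) + |R| * absSum ω))
      ≤ 1 * gWeight c (s t) ω φ := by
    intro φ
    rw [one_mul]
    apply Real.exp_le_exp.2
    have h1 := neg_le_of_abs_le (abs_exponent_le (hs t) hc1 ω φ)
    have h2 := mul_le_mul_of_nonneg_right (le_abs_self R) (absSum_nonneg ω)
    linarith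
  have h2 := integral_mono (μ := ρ) (integrable_const _)
    (integrable_mul_gWeight ρ hc (s t) ω (BddMeas.const 1)) h
  rw [integral_const, smul_eq_mul] at h2
  rw [abs_of_pos (inv_pos.2 (gInt_one_pos ρ hc _ _)), mul_assoc, ← Real.exp_add]
  refine (inv_anti₀ (by positivity) h2).trans (le_of_eq ?_)
  rw [mul_inv, Real.exp_neg, inv_inv]

/-- From `1 - W⁻¹ ≤ log W ≤ W - 1`, the logarithm is dominated by `W + W⁻¹`. -/
lemma expBounded_log_gInt_one [NeZero ρ] (hs : ∀ t k, |s t k| ≤ R) (hc : ∀ k, BddMeas (c k))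
    (hc1 : ∀ k φ, |c k φ| ≤ 1) :
    ExpBounded fun t ω => Real.log (gInt ρ c (s t) (fun _ => 1) ω) := by
  refine ((expBounded_gInt_one ρ hs hc1).add (expBounded_inv_gInt_one ρ hs hc hc1)).mono
    fun t ω => ?_
  have h0 := gInt_one_pos ρ hc (s t) ω
  have h1 := inv_pos.2 h0
  rw [abs_of_pos (add_pos h0 h1), abs_le]
  have h2 := Real.log_le_sub_one_of_pos h0
  have h3 := Real.one_sub_inv_le_log_of_pos h0
  constructor <;> linarith

end Growth

/-- The exponent is affine in `ω k` with slope `s k * c k φ`, so differentiating inserts `c k` into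
the integrand. This feeds the integration by parts. -/
lemma hasDerivAt_gInt_single [DecidableEq κ] (hc : ∀ k, BddMeas (c k)) (s : κ → ℝ) {f : S → ℝ}
    (hf : BddMeas f) (ω : κ → ℝ) (k : κ) :
    HasDerivAt (fun ε : ℝ => gInt ρ c s f (ω + Pi.single k ε))
      (s k * gInt ρ c s (fun φ => f φ * c k φ) ω) 0 := by
  have hlin : ∀ (ε : ℝ) φ, ∑ j, (s j * (ω + Pi.single k ε : κ → ℝ) j * c j φ - s j ^ 2 * c j φ ^ 2 / 2)
      = (∑ j, (s j * ω j * c j φ - s j ^ 2 * c j φ ^ 2 / 2)) + ε * (s k * c k φ) := by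
    intro ε φ
    simp only [Pi.add_apply, mul_add, add_mul, add_sub_right_comm, Finset.sum_add_distrib]
    congr 1
    rw [Finset.sum_eq_single k]
    · simp; ring
    · intro j _ hj; simp [hj]
    · simp
  obtain ⟨hem, K, hK⟩ := bddMeas_exponent hc s ω
  obtain ⟨hlm, K', hK'⟩ := (BddMeas.const (s k)).mul (hc k)
  have := hasDerivAt_integral_mul_exp ρ hf (K := |K| + |K'|) 0
    (l := fun ε φ => (∑ j, (s j * ω j * c j φ - s j ^ 2 * c j φ ^ 2 / 2)) + ε * (s k * c k φ))
    (l' := fun _ φ => s k * c k φ)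
    (fun ε => hem.add (hlm.const_mul ε)) (fun _ => hlm)
    (fun ε φ => (((hasDerivAt_id ε).mul_const (s k * c k φ)).const_add _).congr_deriv
      (one_mul _))
    (fun φ => by
      rw [zero_mul, add_zero]
      exact ((hK φ).trans (le_abs_self K)).trans (le_add_of_nonneg_right (abs_nonneg K')))
    (fun _ φ => ((hK' φ).trans (le_abs_self K')).trans (le_add_of_nonneg_left (abs_nonneg K)))
  refine HasDerivAt.congr_deriv (f' := ∫ φ, f φ * (s k * c k φ * gWeight c s ω φ) ∂ρ) ?_ ?_
  · simpa only [gInt, gWeight, hlin, zero_mul, add_zero] using this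
  · rw [gInt, ← integral_const_mul]
    exact integral_congr_ae (ae_of_all _ fun φ => by simp only; ring)

/-- The exponent is linear plus quadratic in the amplitudes. The linear part leaves an explicit
factor `ω k`, later removed by integration by parts; the quadratic part produces the counterterm
with `c k ^ 2`. -/
lemma hasDerivAt_gInt_param (hc : ∀ k, BddMeas (c k)) (hc1 : ∀ k φ, |c k φ| ≤ 1)
    {s s' : ℝ → κ → ℝ} {R : ℝ} (hs : ∀ t k, |s t k| ≤ R) (hs' : ∀ t k, |s' t k| ≤ R)
    (hd : ∀ t k, HasDerivAt (fun t => s t k) (s' t k) t) {f : S → ℝ} (hf : BddMeas f)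
    (ω : κ → ℝ) (t : ℝ) :
    HasDerivAt (fun t => gInt ρ c (s t) f ω)
      (∑ k, (s' t k * ω k * gInt ρ c (s t) (fun φ => f φ * c k φ) ω
        - s t k * s' t k * gInt ρ c (s t) (fun φ => f φ * c k φ ^ 2) ω)) t := by
  have hcm : ∀ k, Measurable (c k) := fun k => (hc k).measurable
  have hbnd : ∀ t k φ, |s' t k * ω k * c k φ - s t k * s' t k * c k φ ^ 2|
      ≤ |R| * |ω k| + |R| * |R| := by
    intro t k φ
    have h1 := (hs t k).trans (le_abs_self R)
    have h2 := (hs' t k).trans (le_abs_self R)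
    refine (abs_sub _ _).trans (add_le_add ?_ ?_)
    · rw [abs_mul, abs_mul]
      calc |s' t k| * |ω k| * |c k φ| ≤ |R| * |ω k| * 1 := by gcongr; exact hc1 k φ
        _ = _ := mul_one _
    · rw [abs_mul, abs_mul, abs_pow]
      calc |s t k| * |s' t k| * |c k φ| ^ 2 ≤ |R| * |R| * 1 ^ 2 := by gcongr; exact hc1 k φ
        _ = _ := by ring
  have := hasDerivAt_integral_mul_exp ρ hf
    (K := |R| * absSum ω + Fintype.card κ * (|R| * |R|)) t
    (l := fun t φ => ∑ k, (s t k * ω k * c k φ - s t k ^ 2 * c k φ ^ 2 / 2))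
    (l' := fun t φ => ∑ k, (s' t k * ω k * c k φ - s t k * s' t k * c k φ ^ 2))
    (fun t => by fun_prop) (fun t => by fun_prop)
    (fun t φ => HasDerivAt.fun_sum fun k _ => by
      refine ((((hd t k).mul_const (ω k)).mul_const (c k φ)).sub
        ((((hd t k).pow 2).mul_const (c k φ ^ 2)).div_const 2)).congr_deriv ?_
      ring)
    (fun φ => by
      refine (abs_exponent_le (hs t) hc1 ω φ).trans (add_le_add ?_ ?_)
      · exact mul_le_mul_of_nonneg_right (le_abs_self R) (absSum_nonneg ω)
      · refine mul_le_mul_of_nonneg_left ?_ (Nat.cast_nonneg _)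
        rw [abs_mul_abs_self]; nlinarith [sq_nonneg R])
    (fun t φ => by
      refine (Finset.abs_sum_le_sum_abs _ _).trans
        ((Finset.sum_le_sum fun k _ => hbnd t k φ).trans (le_of_eq ?_))
      simp [Finset.sum_add_distrib, absSum, Finset.mul_sum])
  refine this.congr_deriv ?_
  have hi : ∀ k, Integrable (fun φ => s' t k * ω k * (f φ * c k φ * gWeight c (s t) ω φ)) ρ :=
    fun k => (integrable_mul_gWeight ρ hc _ _ (hf.mul (hc k))).const_mul _
  have hi' : ∀ k, Integrable
      (fun φ => s t k * s' t k * (f φ * c k φ ^ 2 * gWeight c (s t) ω φ)) ρ :=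
    fun k => (integrable_mul_gWeight ρ hc _ _ (hf.mul ((hc k).pow 2))).const_mul _
  simp only [gInt, ← integral_const_mul]
  simp only [← integral_sub (hi _) (hi' _)]
  rw [← integral_finsetSum (f := fun k φ => s' t k * ω k * (f φ * c k φ * gWeight c (s t) ω φ)
    - s t k * s' t k * (f φ * c k φ ^ 2 * gWeight c (s t) ω φ)) _ fun k _ => (hi k).sub (hi' k)]
  refine integral_congr_ae (ae_of_all _ fun φ => ?_)
  simp only [gWeight, Finset.sum_mul, Finset.mul_sum]
  exact Finset.sum_congr rfl fun k _ => by ring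

end GaussianChannel

/-! ### Convexity of the entropy of a Gaussian channel -/

section HeatFlow

variable {κ : Type*} [Fintype κ] [DecidableEq κ]

/-- Differentiation of a Gaussian expectation along a path of amplitudes: the terms that are
linear in the disorder are integrated by parts. -/
lemma hasDerivAt_integral_stdGaussianPi {s s' : ℝ → κ → ℝ} {R : ℝ}
    (hs : ∀ t k, |s t k| ≤ R) (hs' : ∀ t k, |s' t k| ≤ R)
    {G : ℝ → (κ → ℝ) → ℝ} {A B C : κ → ℝ → (κ → ℝ) → ℝ}
    (hG : ∀ t ω, HasDerivAt (fun t => G t ω)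
      (∑ k, (s' t k * ω k * A k t ω - s t k * s' t k * B k t ω)) t)
    (hA : ∀ k t ω, HasDerivAt (fun ε : ℝ => A k t (ω + Pi.single k ε))
      (s t k * (B k t ω + C k t ω)) 0)
    (mG : ∀ t, Measurable (G t)) (mA : ∀ k t, Measurable (A k t))
    (mB : ∀ k t, Measurable (B k t)) (mC : ∀ k t, Measurable (C k t))
    (bG : ExpBounded G) (bA : ∀ k, ExpBounded (A k)) (bB : ∀ k, ExpBounded (B k))
    (bC : ∀ k, ExpBounded (C k)) (t : ℝ) :
    HasDerivAt (fun t => ∫ ω, G t ω ∂stdGaussianPi κ)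
      (∑ k, s t k * s' t k * ∫ ω, C k t ω ∂stdGaussianPi κ) t := by
  have bs : ∀ k, ExpBounded (fun t (_ : κ → ℝ) => s t k) := fun k =>
    ExpBounded.of_bounded (fun t => hs t k)
  have bs' : ∀ k, ExpBounded (fun t (_ : κ → ℝ) => s' t k) := fun k =>
    ExpBounded.of_bounded (fun t => hs' t k)
  have bD : ExpBounded fun t ω => ∑ k, (s' t k * ω k * A k t ω - s t k * s' t k * B k t ω) :=
    ExpBounded.sum _ fun k _ => (((bs' k).mul (.coord k)).mul (bA k)).sub
      (((bs k).mul (bs' k)).mul (bB k))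
  have mD : ∀ t, Measurable fun ω => ∑ k, (s' t k * ω k * A k t ω - s t k * s' t k * B k t ω) :=
    fun t => by fun_prop
  obtain ⟨K, b, -, -, hK⟩ := bD
  refine (hasDerivAt_integral_of_dominated_loc_of_deriv_le (F := G)
    (bound := fun ω => K * Real.exp (b * absSum ω))
    (Metric.ball_mem_nhds t one_pos)
    (Filter.Eventually.of_forall fun t => (mG t).aestronglyMeasurable)
    (bG.integrable t (mG t)) (mD t).aestronglyMeasurable
    (ae_of_all _ fun ω t _ => hK t ω) ((integrable_exp_absSum b).const_mul K)
    (ae_of_all _ fun ω t _ => hG t ω)).2.congr_deriv ?_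
  have i1 : ∀ k, Integrable (fun ω => s' t k * ω k * A k t ω) (stdGaussianPi κ) := fun k =>
    (((bs' k).mul (.coord k)).mul (bA k)).integrable t (by fun_prop)
  have i2 : ∀ k, Integrable (fun ω => s t k * s' t k * B k t ω) (stdGaussianPi κ) := fun k =>
    (((bs k).mul (bs' k)).mul (bB k)).integrable t (by fun_prop)
  have i3 : ∀ k, Integrable (fun ω => s' t k * ω k * A k t ω - s t k * s' t k * B k t ω)
      (stdGaussianPi κ) := fun k => (i1 k).sub (i2 k)
  rw [integral_finsetSum _ fun k _ => i3 k]
  refine Finset.sum_congr rfl fun k _ => ?_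
  -- Integrating `ω k * A k` by parts gives `s k * (B k + C k)`. The `B k` part cancels the
  -- counterterm of the quadratic correction, and only `C k` survives.
  have ibp := integral_coord_mul_stdGaussianPi k (h := A k)
    (h' := fun t ω => s t k * (B k t ω + C k t ω)) t (hA k t) (mA k t)
    (by fun_prop) (bA k) ((bs k).mul ((bB k).add (bC k)))
  rw [integral_const_mul, integral_add ((bB k).integrable t (mB k t))
    ((bC k).integrable t (mC k t))] at ibp
  rw [integral_sub (i1 k) (i2 k), integral_const_mul]
  simp only [mul_assoc (s' t k)]
  rw [integral_const_mul, ibp]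
  ring

end HeatFlow

/-! ### First and second derivatives of the entropy, and its tangent inequality. -/

section Convexity

variable {κ S : Type*} [Fintype κ] [DecidableEq κ] [MeasurableSpace S] (ρ : Measure S)
  [IsFiniteMeasure ρ] [NeZero ρ] {c : κ → S → ℝ}

/-- The derivative of `W log W` carries the factor `log W + 1`. When integration by parts
differentiates this factor, the term `X_k² / W` appears, with `X_k` the unnormalized average of `c
k`. Since `s * s'` is half the derivative of `s²`, these are the partial derivatives in the squared
amplitudes, up to a factor `2`. -/
lemma hasDerivAt_integral_entropy (hc : ∀ k, BddMeas (c k)) (hc1 : ∀ k φ, |c k φ| ≤ 1)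
    {s s' : ℝ → κ → ℝ} {R : ℝ} (hs : ∀ t k, |s t k| ≤ R) (hs' : ∀ t k, |s' t k| ≤ R)
    (hd : ∀ t k, HasDerivAt (fun t => s t k) (s' t k) t) (t : ℝ) :
    HasDerivAt (fun t => ∫ ω, gInt ρ c (s t) (fun _ => 1) ω
        * Real.log (gInt ρ c (s t) (fun _ => 1) ω) ∂stdGaussianPi κ)
      (∑ k, s t k * s' t k * ∫ ω, gInt ρ c (s t) (c k) ω ^ 2
        * (gInt ρ c (s t) (fun _ => 1) ω)⁻¹ ∂stdGaussianPi κ) t := by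
  have h1 : BddMeas (fun _ : S => (1 : ℝ)) := .const 1
  have mX : ∀ t {f : S → ℝ}, BddMeas f → Measurable (gInt ρ c (s t) f) := fun t f hf =>
    measurable_gInt ρ hc (s t) hf
  have bX : ∀ {f : S → ℝ}, BddMeas f → ExpBounded fun t => gInt ρ c (s t) f := fun hf =>
    expBounded_gInt ρ hs hc hc1 hf
  have bL := expBounded_log_gInt_one ρ hs hc hc1
  have bI := expBounded_inv_gInt_one ρ hs hc hc1
  have mW := fun t => mX t h1
  have mk := fun k t => mX t (hc k)
  have mkk := fun k t => mX t ((hc k).pow 2)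
  refine hasDerivAt_integral_stdGaussianPi hs hs'
    (A := fun k t ω => (Real.log (gInt ρ c (s t) (fun _ => 1) ω) + 1) * gInt ρ c (s t) (c k) ω)
    (B := fun k t ω => (Real.log (gInt ρ c (s t) (fun _ => 1) ω) + 1)
      * gInt ρ c (s t) (fun φ => c k φ ^ 2) ω)
    (C := fun k t ω => gInt ρ c (s t) (c k) ω ^ 2 * (gInt ρ c (s t) (fun _ => 1) ω)⁻¹)
    ?_ ?_ (fun t => (mW t).mul (mW t).log)
    (fun k t => ((mW t).log.add_const 1).mul (mk k t))
    (fun k t => ((mW t).log.add_const 1).mul (mkk k t))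
    (fun k t => ((mk k t).pow_const 2).mul (mW t).inv)
    ((bX h1).mul bL) (fun k => (bL.add (.const 1)).mul (bX (hc k)))
    (fun k => (bL.add (.const 1)).mul (bX ((hc k).pow 2)))
    (fun k => ((bX (hc k)).pow 2).mul bI) t
  · intro t ω
    have hW := (gInt_one_pos ρ hc (s t) ω).ne'
    have h := hasDerivAt_gInt_param ρ hc hc1 hs hs' hd h1 ω t
    simp only [one_mul] at h
    refine (h.mul (h.log hW)).congr_deriv ?_
    rw [mul_div_cancel₀ _ hW, ← mul_add_one, Finset.sum_mul]
    exact Finset.sum_congr rfl fun k _ => by ring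
  · intro k t ω
    have hW := (gInt_one_pos ρ hc (s t) ω).ne'
    have h := hasDerivAt_gInt_single ρ hc (s t) h1 ω k
    have hk := hasDerivAt_gInt_single ρ hc (s t) (hc k) ω k
    simp only [one_mul, ← pow_two] at h hk
    have hW' : gInt ρ c (s t) (fun _ => 1) (ω + Pi.single k 0) ≠ 0 := by simpa using hW
    refine (((h.log hW').add_const 1).mul hk).congr_deriv ?_
    simp only [Pi.single_zero, add_zero]
    field_simp
    ring

/-- For `f = c j` this differentiates the gradient of the entropy. After integration by parts the
surviving terms combine into a perfect square: twice `W` times the squared covariance of `f` and `c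
k`. -/
lemma hasDerivAt_integral_sq_div (hc : ∀ k, BddMeas (c k)) (hc1 : ∀ k φ, |c k φ| ≤ 1)
    {s s' : ℝ → κ → ℝ} {R : ℝ} (hs : ∀ t k, |s t k| ≤ R) (hs' : ∀ t k, |s' t k| ≤ R)
    (hd : ∀ t k, HasDerivAt (fun t => s t k) (s' t k) t) {f : S → ℝ} (hf : BddMeas f) (t : ℝ) :
    HasDerivAt (fun t => ∫ ω, gInt ρ c (s t) f ω ^ 2
        * (gInt ρ c (s t) (fun _ => 1) ω)⁻¹ ∂stdGaussianPi κ)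
      (∑ k, s t k * s' t k * ∫ ω, 2 * (gInt ρ c (s t) (fun _ => 1) ω)⁻¹
        * (gInt ρ c (s t) (fun φ => f φ * c k φ) ω
          - gInt ρ c (s t) f ω * gInt ρ c (s t) (c k) ω
            * (gInt ρ c (s t) (fun _ => 1) ω)⁻¹) ^ 2 ∂stdGaussianPi κ) t := by
  have h1 : BddMeas (fun _ : S => (1 : ℝ)) := .const 1
  have mX : ∀ t {f : S → ℝ}, BddMeas f → Measurable (gInt ρ c (s t) f) := fun t f hf =>
    measurable_gInt ρ hc (s t) hf
  have bX : ∀ {f : S → ℝ}, BddMeas f → ExpBounded fun t => gInt ρ c (s t) f := fun hf =>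
    expBounded_gInt ρ hs hc hc1 hf
  have bI := expBounded_inv_gInt_one ρ hs hc hc1
  have mI := fun t => (mX t h1).inv
  have mk := fun k t => mX t (hc k)
  have mkk := fun k t => mX t ((hc k).pow 2)
  have mf := fun t => mX t hf
  have mfk := fun k t => mX t (hf.mul (hc k))
  have mfkk := fun k t => mX t (hf.mul ((hc k).pow 2))
  have bf := bX hf
  refine hasDerivAt_integral_stdGaussianPi hs hs'
    (A := fun k t ω => 2 * gInt ρ c (s t) f ω * (gInt ρ c (s t) (fun _ => 1) ω)⁻¹
        * gInt ρ c (s t) (fun φ => f φ * c k φ) ω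
      - (gInt ρ c (s t) f ω * (gInt ρ c (s t) (fun _ => 1) ω)⁻¹) ^ 2 * gInt ρ c (s t) (c k) ω)
    (B := fun k t ω => 2 * gInt ρ c (s t) f ω * (gInt ρ c (s t) (fun _ => 1) ω)⁻¹
        * gInt ρ c (s t) (fun φ => f φ * c k φ ^ 2) ω
      - (gInt ρ c (s t) f ω * (gInt ρ c (s t) (fun _ => 1) ω)⁻¹) ^ 2
        * gInt ρ c (s t) (fun φ => c k φ ^ 2) ω)
    (C := fun k t ω => 2 * (gInt ρ c (s t) (fun _ => 1) ω)⁻¹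
        * (gInt ρ c (s t) (fun φ => f φ * c k φ) ω
          - gInt ρ c (s t) f ω * gInt ρ c (s t) (c k) ω
            * (gInt ρ c (s t) (fun _ => 1) ω)⁻¹) ^ 2)
    ?_ ?_ (fun t => ((mf t).pow_const 2).mul (mI t))
    (fun k t => ((((mf t).const_mul 2).mul (mI t)).mul (mfk k t)).sub
      ((((mf t).mul (mI t)).pow_const 2).mul (mk k t)))
    (fun k t => ((((mf t).const_mul 2).mul (mI t)).mul (mfkk k t)).sub
      ((((mf t).mul (mI t)).pow_const 2).mul (mkk k t)))
    (fun k t => ((mI t).const_mul 2).mul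
      (((mfk k t).sub (((mf t).mul (mk k t)).mul (mI t))).pow_const 2))
    ((bf.pow 2).mul bI)
    (fun k => ((((ExpBounded.const 2).mul bf).mul bI).mul (bX (hf.mul (hc k)))).sub
      (((bf.mul bI).pow 2).mul (bX (hc k))))
    (fun k => ((((ExpBounded.const 2).mul bf).mul bI).mul (bX (hf.mul ((hc k).pow 2)))).sub
      (((bf.mul bI).pow 2).mul (bX ((hc k).pow 2))))
    (fun k => ((ExpBounded.const 2).mul bI).mul
      (((bX (hf.mul (hc k))).sub ((bf.mul (bX (hc k))).mul bI)).pow 2)) t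
  · intro t ω
    have hW := (gInt_one_pos ρ hc (s t) ω).ne'
    have h := hasDerivAt_gInt_param ρ hc hc1 hs hs' hd h1 ω t
    have hf' := hasDerivAt_gInt_param ρ hc hc1 hs hs' hd hf ω t
    simp only [one_mul] at h
    refine ((hf'.pow 2).mul (h.inv hW)).congr_deriv ?_
    simp only [Nat.cast_ofNat, Nat.add_one_sub_one, pow_one, Pi.pow_apply, Pi.inv_apply]
    rw [neg_div, ← sub_eq_zero]
    set W := gInt ρ c (s t) (fun _ => 1) ω
    set F := gInt ρ c (s t) f ω
    rw [show ∀ a b : ℝ, 2 * F * a * W⁻¹ + F ^ 2 * -(b / W ^ 2)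
      = a * (2 * F * W⁻¹) - b * (F * W⁻¹) ^ 2 from fun a b => by ring,
      Finset.sum_mul, Finset.sum_mul, ← Finset.sum_sub_distrib, ← Finset.sum_sub_distrib]
    exact Finset.sum_eq_zero fun k _ => by ring
  · intro k t ω
    have hW := (gInt_one_pos ρ hc (s t) ω).ne'
    have h := hasDerivAt_gInt_single ρ hc (s t) h1 ω k
    have hk := hasDerivAt_gInt_single ρ hc (s t) (hc k) ω k
    have hf' := hasDerivAt_gInt_single ρ hc (s t) hf ω k
    have hfk := hasDerivAt_gInt_single ρ hc (s t) (hf.mul (hc k)) ω k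
    simp only [one_mul, mul_assoc, ← pow_two] at h hk hf' hfk
    have hW' : gInt ρ c (s t) (fun _ => 1) (ω + Pi.single k 0) ≠ 0 := by simpa using hW
    refine ((((hf'.const_mul 2).mul (h.inv hW')).mul hfk).sub
      (((hf'.mul (h.inv hW')).pow 2).mul hk)).congr_deriv ?_
    simp only [Pi.single_zero, add_zero, Nat.cast_ofNat, Nat.add_one_sub_one, pow_one,
      Pi.pow_apply, Pi.inv_apply, Pi.mul_apply]
    field_simp
    ring

omit [DecidableEq κ] [NeZero ρ] in
-- A squared integral is an integral over two independent replicas. Under the double integral the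
-- quadratic form becomes the square of `∑ j, d j * u j p.1 * u j p.2`.
lemma sum_mul_sq_integral_nonneg {u : κ → S → ℝ} (hu : ∀ k, BddMeas (u k)) (ν : Measure S)
    [IsFiniteMeasure ν] (d : κ → ℝ) :
    0 ≤ ∑ j, ∑ k, d j * d k * (∫ φ, u j φ * u k φ ∂ν) ^ 2 := by
  have h1 : ∀ j k, d j * d k * (∫ φ, u j φ * u k φ ∂ν) ^ 2
      = ∫ p, d j * d k * ((u j p.1 * u k p.1) * (u j p.2 * u k p.2)) ∂ν.prod ν := fun j k => by
    rw [integral_const_mul, integral_prod_mul (μ := ν) (ν := ν) (fun φ => u j φ * u k φ)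
      (fun φ => u j φ * u k φ), pow_two]
  have h2 : ∀ j k, Integrable
      (fun p : S × S => d j * d k * ((u j p.1 * u k p.1) * (u j p.2 * u k p.2))) (ν.prod ν) :=
    fun j k => ((((hu j).mul (hu k)).integrable ν).mul_prod
      (((hu j).mul (hu k)).integrable ν)).const_mul _
  simp only [h1]
  simp only [← integral_finsetSum _ fun k _ => h2 _ k]
  rw [← integral_finsetSum _ fun j _ => integrable_finsetSum _ fun k _ => h2 j k]
  refine integral_nonneg fun p => ?_
  have : ∑ j, ∑ k, d j * d k * ((u j p.1 * u k p.1) * (u j p.2 * u k p.2))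
      = (∑ j, d j * (u j p.1 * u j p.2)) ^ 2 := by
    rw [pow_two, Finset.sum_mul_sum]
    exact Finset.sum_congr rfl fun j _ => Finset.sum_congr rfl fun k _ => by ring
  simp only [this]
  positivity

/-- The matrix of squared covariances is positive semidefinite. -/
lemma sum_mul_covariance_sq_nonneg (hc : ∀ k, BddMeas (c k)) (s ω d : κ → ℝ) :
    0 ≤ ∑ j, ∑ k, d j * d k * (gInt ρ c s (fun φ => c j φ * c k φ) ω
      - gInt ρ c s (c j) ω * gInt ρ c s (c k) ω * (gInt ρ c s (fun _ => 1) ω)⁻¹) ^ 2 := by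
  set W := gInt ρ c s (fun _ => 1) ω
  have hW : W ≠ 0 := (gInt_one_pos ρ hc s ω).ne'
  let a : κ → ℝ := fun k => gInt ρ c s (c k) ω * W⁻¹
  -- Centred observables multiplied by the square root of the weight: the integral of `u j * u k` is
  -- then the unnormalized covariance.
  let u : κ → S → ℝ := fun k φ => Real.sqrt (gWeight c s ω φ) * (c k φ - a k)
  have hg := bddMeas_gWeight hc s ω
  have hsq : BddMeas fun φ => Real.sqrt (gWeight c s ω φ) := by
    refine ⟨hg.measurable.sqrt, ?_⟩
    obtain ⟨K, hK⟩ := hg.bdd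
    refine ⟨Real.sqrt K, fun φ => ?_⟩
    rw [abs_of_nonneg (Real.sqrt_nonneg _)]
    exact Real.sqrt_le_sqrt ((le_abs_self _).trans (hK φ))
  have hu : ∀ k, BddMeas (u k) := fun k => hsq.mul ((hc k).sub (.const _))
  refine (sum_mul_sq_integral_nonneg hu ρ d).trans (le_of_eq ?_)
  refine Finset.sum_congr rfl fun j _ => Finset.sum_congr rfl fun k _ => ?_
  congr 2
  have hi := fun {f : S → ℝ} (hf : BddMeas f) => integrable_mul_gWeight ρ hc s ω hf
  have e : ∀ φ, u j φ * u k φ = c j φ * c k φ * gWeight c s ω φ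
      - a k * (c j φ * gWeight c s ω φ) - a j * (c k φ * gWeight c s ω φ)
      + a j * a k * (1 * gWeight c s ω φ) := fun φ => by
    have := Real.mul_self_sqrt (gWeight_pos c s ω φ).le
    simp only [u]
    linear_combination (c j φ - a j) * (c k φ - a k) * this
  simp only [e]
  have i0 := hi ((hc j).mul (hc k))
  have i1 := (hi (hc j)).const_mul (a k)
  have i2 := (hi (hc k)).const_mul (a j)
  have i3 := (hi (.const 1)).const_mul (a j * a k)
  have i01 : Integrable (fun φ => c j φ * c k φ * gWeight c s ω φ
      - a k * (c j φ * gWeight c s ω φ)) ρ := i0.sub i1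
  have i012 : Integrable (fun φ => c j φ * c k φ * gWeight c s ω φ
      - a k * (c j φ * gWeight c s ω φ) - a j * (c k φ * gWeight c s ω φ)) ρ := i01.sub i2
  rw [integral_add i012 i3, integral_sub i01 i2, integral_sub i0 i1,
    integral_const_mul, integral_const_mul, integral_const_mul]
  change gInt ρ c s (fun φ => c j φ * c k φ) ω - a k * gInt ρ c s (c j) ω
    - a j * gInt ρ c s (c k) ω + a j * a k * W = _
  simp only [a]
  field_simp
  ring

/-- The entropy of a Gaussian channel lies above its tangents, as a function of the squared
amplitudes. -/
theorem entropy_tangent_le (hc : ∀ k, BddMeas (c k)) (hc1 : ∀ k φ, |c k φ| ≤ 1)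
    (a b : κ → ℝ) (hab : ∀ k, a k * b k = 0) :
    (∫ ω, gInt ρ c b (fun _ => 1) ω * Real.log (gInt ρ c b (fun _ => 1) ω) ∂stdGaussianPi κ)
      + 1 / 2 * ∑ k, (a k ^ 2 - b k ^ 2) * ∫ ω, gInt ρ c b (c k) ω ^ 2
        * (gInt ρ c b (fun _ => 1) ω)⁻¹ ∂stdGaussianPi κ
    ≤ ∫ ω, gInt ρ c a (fun _ => 1) ω * Real.log (gInt ρ c a (fun _ => 1) ω)
        ∂stdGaussianPi κ := by
  -- Since `a k * b k = 0`, the squared amplitudes along this path are `a² sin² t + b² cos² t`,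
  -- which is a segment from `b²` to `a²`. The trigonometric parametrization keeps the amplitudes
  -- smooth even where one of them vanishes.
  let s : ℝ → κ → ℝ := fun t k => a k * Real.sin t + b k * Real.cos t
  let s' : ℝ → κ → ℝ := fun t k => a k * Real.cos t - b k * Real.sin t
  let R := ∑ k, (|a k| + |b k|)
  have hR : ∀ k, |a k| + |b k| ≤ R := fun k =>
    Finset.single_le_sum (f := fun k => |a k| + |b k|) (fun _ _ => by positivity)
      (Finset.mem_univ k)
  have hs : ∀ t k, |s t k| ≤ R := fun t k => by
    refine (abs_add_le _ _).trans (le_trans (add_le_add ?_ ?_) (hR k)) <;> rw [abs_mul]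
    · exact mul_le_of_le_one_right (abs_nonneg _) (Real.abs_sin_le_one t)
    · exact mul_le_of_le_one_right (abs_nonneg _) (Real.abs_cos_le_one t)
  have hs' : ∀ t k, |s' t k| ≤ R := fun t k => by
    refine (abs_sub _ _).trans (le_trans (add_le_add ?_ ?_) (hR k)) <;> rw [abs_mul]
    · exact mul_le_of_le_one_right (abs_nonneg _) (Real.abs_cos_le_one t)
    · exact mul_le_of_le_one_right (abs_nonneg _) (Real.abs_sin_le_one t)
  have hd : ∀ t k, HasDerivAt (fun t => s t k) (s' t k) t := fun t k =>
    (((Real.hasDerivAt_sin t).const_mul (a k)).add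
      ((Real.hasDerivAt_cos t).const_mul (b k))).congr_deriv (by simp only [s']; ring)
  have hss : ∀ t k, s t k * s' t k = Real.sin t * Real.cos t * (a k ^ 2 - b k ^ 2) := fun t k => by
    simp only [s, s']
    linear_combination (Real.cos t ^ 2 - Real.sin t ^ 2) * hab k
  let F : ℝ → ℝ := fun t => ∫ ω, gInt ρ c (s t) (fun _ => 1) ω
    * Real.log (gInt ρ c (s t) (fun _ => 1) ω) ∂stdGaussianPi κ
  let m : ℝ → ℝ := fun t => ∑ k, (a k ^ 2 - b k ^ 2) * ∫ ω, gInt ρ c (s t) (c k) ω ^ 2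
        * (gInt ρ c (s t) (fun _ => 1) ω)⁻¹ ∂stdGaussianPi κ
  have hF : ∀ t, HasDerivAt F (Real.sin t * Real.cos t * m t) t := fun t => by
    refine (hasDerivAt_integral_entropy ρ hc hc1 hs hs' hd t).congr_deriv ?_
    simp only [m, Finset.mul_sum, hss, mul_assoc]
  let D : ℝ → κ → κ → (κ → ℝ) → ℝ := fun t j k ω => 2 * (gInt ρ c (s t) (fun _ => 1) ω)⁻¹
        * (gInt ρ c (s t) (fun φ => c j φ * c k φ) ω
          - gInt ρ c (s t) (c j) ω * gInt ρ c (s t) (c k) ω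
            * (gInt ρ c (s t) (fun _ => 1) ω)⁻¹) ^ 2
  have hDint : ∀ t j k, Integrable (D t j k) (stdGaussianPi κ) := fun t j k => by
    have mX : ∀ {f : S → ℝ}, BddMeas f → Measurable (gInt ρ c (s t) f) := fun hf =>
      measurable_gInt ρ hc (s t) hf
    have bX : ∀ {f : S → ℝ}, BddMeas f → ExpBounded fun t => gInt ρ c (s t) f := fun hf =>
      expBounded_gInt ρ hs hc hc1 hf
    have bI := expBounded_inv_gInt_one ρ hs hc hc1
    have mI := (mX (.const 1)).inv
    exact (((ExpBounded.const 2).mul bI).mul (((bX ((hc j).mul (hc k))).sub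
      (((bX (hc j)).mul (bX (hc k))).mul bI)).pow 2)).integrable t
      ((mI.const_mul 2).mul (((mX ((hc j).mul (hc k))).sub
        (((mX (hc j)).mul (mX (hc k))).mul mI)).pow_const 2))
  have hm : ∀ t, HasDerivAt m (Real.sin t * Real.cos t * ∑ j, ∑ k,
      (a j ^ 2 - b j ^ 2) * (a k ^ 2 - b k ^ 2) * ∫ ω, D t j k ω ∂stdGaussianPi κ) t := fun t => by
    refine (HasDerivAt.fun_sum fun j _ =>
      (hasDerivAt_integral_sq_div ρ hc hc1 hs hs' hd (hc j) t).const_mul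
        (a j ^ 2 - b j ^ 2)).congr_deriv ?_
    simp only [Finset.mul_sum, hss]
    exact Finset.sum_congr rfl fun j _ => Finset.sum_congr rfl fun k _ => by
      simp only [D]; ring
  have hpos : ∀ t, 0 ≤ ∑ j, ∑ k,
      (a j ^ 2 - b j ^ 2) * (a k ^ 2 - b k ^ 2) * ∫ ω, D t j k ω ∂stdGaussianPi κ := fun t => by
    simp only [← integral_const_mul]
    simp only [← integral_finsetSum _ fun k _ => (hDint t _ k).const_mul _]
    rw [← integral_finsetSum _ fun j _ => integrable_finsetSum _ fun k _ =>
      (hDint t j k).const_mul _]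
    refine integral_nonneg fun ω => ?_
    have h1 := sum_mul_covariance_sq_nonneg ρ hc (s t) ω fun k => a k ^ 2 - b k ^ 2
    have h2 : 0 ≤ 2 * (gInt ρ c (s t) (fun _ => 1) ω)⁻¹ :=
      mul_nonneg zero_le_two (inv_pos.2 (gInt_one_pos ρ hc (s t) ω)).le
    refine (mul_nonneg h2 h1).trans (le_of_eq ?_)
    simp only [Finset.mul_sum]
    exact Finset.sum_congr rfl fun j _ => Finset.sum_congr rfl fun k _ => by
      simp only [D]; ring
  have hsc : ∀ t ∈ Set.Icc 0 (Real.pi / 2), 0 ≤ Real.sin t * Real.cos t := fun t ht =>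
    mul_nonneg (Real.sin_nonneg_of_mem_Icc ⟨ht.1, by linarith [ht.2, Real.pi_pos]⟩)
      (Real.cos_nonneg_of_mem_Icc ⟨by linarith [ht.1, Real.pi_pos], ht.2⟩)
  -- In the parameter `sin² t` the slope of the entropy is `m / 2`, and the Hessian form makes `m`
  -- nondecreasing. This is convexity along the segment.
  have hmono : MonotoneOn m (Set.Icc 0 (Real.pi / 2)) :=
    monotoneOn_of_hasDerivWithinAt_nonneg (convex_Icc _ _)
      (fun t _ => (hm t).continuousAt.continuousWithinAt)
      (fun t _ => (hm t).hasDerivWithinAt)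
      (fun t ht => mul_nonneg (hsc t (interior_subset ht)) (hpos t))
  -- Subtracting the tangent at the starting point leaves a function with nonnegative derivative;
  -- comparing the two endpoints gives the claim.
  have hH : ∀ t, HasDerivAt (fun t => F t - 1 / 2 * Real.sin t ^ 2 * m 0)
      (Real.sin t * Real.cos t * (m t - m 0)) t := fun t => by
    refine ((hF t).sub ((((Real.hasDerivAt_sin t).pow 2).const_mul (1 / 2)).mul_const
      (m 0))).congr_deriv ?_
    simp only [Nat.cast_ofNat, Nat.add_one_sub_one, pow_one]
    ring
  have hmono' : MonotoneOn (fun t => F t - 1 / 2 * Real.sin t ^ 2 * m 0)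
      (Set.Icc 0 (Real.pi / 2)) :=
    monotoneOn_of_hasDerivWithinAt_nonneg (convex_Icc _ _)
      (fun t _ => (hH t).continuousAt.continuousWithinAt)
      (fun t _ => (hH t).hasDerivWithinAt)
      (fun t ht => by
        have ht' := interior_subset ht
        exact mul_nonneg (hsc t ht') (sub_nonneg.2
          (hmono ⟨le_rfl, by positivity⟩ ht' ht'.1)))
  have hfin := hmono' (a := 0) (b := Real.pi / 2) ⟨le_rfl, by positivity⟩ ⟨by positivity, le_rfl⟩
    (by positivity)
  have hs0 : s 0 = b := by funext k; simp [s]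
  have hs1 : s (Real.pi / 2) = a := by funext k; simp [s]
  simp only [F, m, hs0, hs1, Real.sin_zero, Real.sin_pi_div_two] at hfin
  linarith

end Convexity

/-! ### Gauge symmetry and the Nishimori line -/

lemma measurable_angle_cos : Measurable Real.Angle.cos := Real.Angle.continuous_cos.measurable

lemma measurable_angle_sin : Measurable Real.Angle.sin := Real.Angle.continuous_sin.measurable

lemma abs_angle_cos_le_one (x : Real.Angle) : |x.cos| ≤ 1 := by
  rw [← Real.Angle.cos_toReal]; exact Real.abs_cos_le_one _

lemma abs_angle_sin_le_one (x : Real.Angle) : |x.sin| ≤ 1 := by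
  rw [← Real.Angle.sin_toReal]; exact Real.abs_sin_le_one _

/-! ### Gaussian pairs: their components, shifts and rotations. -/

section Disorder

variable {ι : Type*} [Fintype ι]

/-- Independent pairs of independent standard Gaussian variables. -/
def stdDisorder (ι : Type*) [Fintype ι] : Measure (ι → ℝ × ℝ) :=
  Measure.pi fun _ => (gaussianReal 0 1).prod (gaussianReal 0 1)

instance : IsProbabilityMeasure (stdDisorder ι) := by
  unfold stdDisorder; infer_instance

instance (D : ι → ℝ) (σ : ι → ℝ≥0) : IsProbabilityMeasure (disorder D σ) := by
  unfold disorder; infer_instance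

/-- Listing the components of the pairs. -/
def flatten : (ι → ℝ × ℝ) ≃ᵐ (ι ⊕ ι → ℝ) :=
  (MeasurableEquiv.arrowProdEquivProdArrow ℝ ℝ ι).trans
    (MeasurableEquiv.sumPiEquivProdPi fun _ : ι ⊕ ι => ℝ).symm

@[simp] lemma flatten_inl (ω : ι → ℝ × ℝ) (a : ι) : flatten ω (.inl a) = (ω a).1 := rfl

@[simp] lemma flatten_inr (ω : ι → ℝ × ℝ) (a : ι) : flatten ω (.inr a) = (ω a).2 := rfl

lemma measurePreserving_flatten :
    MeasurePreserving (flatten (ι := ι)) (stdDisorder ι) (stdGaussianPi (ι ⊕ ι)) :=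
  (measurePreserving_arrowProdEquivProdArrow ℝ ℝ ι (fun _ => gaussianReal 0 1)
    (fun _ => gaussianReal 0 1)).trans
    (measurePreserving_sumPiEquivProdPi_symm fun _ : ι ⊕ ι => gaussianReal 0 1)

lemma integral_comp_flatten (g : (ι ⊕ ι → ℝ) → ℝ) :
    ∫ ω, g (flatten ω) ∂stdDisorder ι = ∫ ω, g ω ∂stdGaussianPi (ι ⊕ ι) :=
  measurePreserving_flatten.integral_comp flatten.measurableEmbedding g

/-- The shift of the disorder by the planted configuration. -/
def shift (s : ι → ℝ) : ι → ℝ × ℝ := fun a => (s a, 0)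

lemma flatten_add_shift (ω : ι → ℝ × ℝ) (s : ι → ℝ) :
    flatten (ω + shift s) = flatten ω + Sum.elim s 0 := by
  funext k
  cases k <;> simp [shift]

lemma measurePreserving_disorder (D : ι → ℝ) (σ : ι → ℝ≥0) :
    MeasurePreserving (fun (ω : ι → ℝ × ℝ) a => (D a + σ a * (ω a).1, σ a * (ω a).2))
      (stdDisorder ι) (disorder D σ) := by
  refine measurePreserving_pi (fun _ => (gaussianReal 0 1).prod (gaussianReal 0 1))
    (fun a => (gaussianReal (D a) (σ a ^ 2)).prod (gaussianReal 0 (σ a ^ 2)))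
    (f := fun a p => (D a + σ a * p.1, σ a * p.2)) fun a => ?_
  have hmul : MeasurePreserving (fun x : ℝ => (σ a : ℝ) * x) (gaussianReal 0 1)
      (gaussianReal 0 (σ a ^ 2)) := by
    refine ⟨by fun_prop, ?_⟩
    rw [gaussianReal_map_const_mul, mul_zero, mul_one]
    congr 1
  have hadd : MeasurePreserving (fun x : ℝ => D a + x) (gaussianReal 0 (σ a ^ 2))
      (gaussianReal (D a) (σ a ^ 2)) := by
    refine ⟨by fun_prop, ?_⟩
    rw [gaussianReal_map_const_add, zero_add]
  exact (hadd.comp hmul).prod hmul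

/-- Simultaneous rotation of the pairs. -/
def rotate (α : ι → Real.Angle) (ω : ι → ℝ × ℝ) : ι → ℝ × ℝ := fun a =>
  ((α a).cos * (ω a).1 - (α a).sin * (ω a).2, (α a).sin * (ω a).1 + (α a).cos * (ω a).2)

lemma measurePreserving_rotate (α : ι → Real.Angle) :
    MeasurePreserving (rotate α) (stdDisorder ι) (stdDisorder ι) := by
  refine measurePreserving_pi (fun _ => (gaussianReal 0 1).prod (gaussianReal 0 1))
    (fun _ => (gaussianReal 0 1).prod (gaussianReal 0 1))
    (f := fun a p => ((α a).cos * p.1 - (α a).sin * p.2, (α a).sin * p.1 + (α a).cos * p.2))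
    fun a => ⟨by fun_prop, ?_⟩
  -- The negative angle matches the opposite orientation of the library's rotation.
  have h := IsGaussian.map_rotation_eq_self (μ := gaussianReal 0 1)
    (by simp [integral_id_gaussianReal]) (-(α a).toReal)
  convert h using 2
  funext p
  simp [ContinuousLinearMap.rotation_apply, Real.Angle.cos_toReal, Real.Angle.sin_toReal,
    sub_eq_add_neg]

lemma rotate_neg_rotate (α : ι → Real.Angle) (ω : ι → ℝ × ℝ) :
    rotate (-α) (rotate α ω) = ω := by
  funext a
  have h := Real.Angle.cos_sq_add_sin_sq (α a)
  ext
  · simp [rotate]; linear_combination (ω a).1 * h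
  · simp [rotate]; linear_combination (ω a).2 * h

/-- Rotation as a measurable equivalence. -/
def rotateEquiv (α : ι → Real.Angle) : (ι → ℝ × ℝ) ≃ᵐ (ι → ℝ × ℝ) where
  toFun := rotate α
  invFun := rotate (-α)
  left_inv := rotate_neg_rotate α
  right_inv := fun ω => by simpa using rotate_neg_rotate (-α) ω
  measurable_toFun := (measurePreserving_rotate α).measurable
  measurable_invFun := (measurePreserving_rotate (-α)).measurable

lemma integral_comp_rotate (α : ι → Real.Angle) (h : (ι → ℝ × ℝ) → ℝ) :
    ∫ ω, h (rotate α ω) ∂stdDisorder ι = ∫ ω, h ω ∂stdDisorder ι :=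
  (measurePreserving_rotate α).integral_comp (rotateEquiv α).measurableEmbedding h

end Disorder

/-! ### From likelihoods to partition functions, gauge transformations and Nishimori identities. -/

section Gauge

variable {ι S : Type*} [Fintype ι] [MeasurableSpace S]

/-- The cosines and sines of the phases. -/
def circ (θ : ι → S → Real.Angle) : ι ⊕ ι → S → ℝ :=
  Sum.elim (fun a φ => (θ a φ).cos) (fun a φ => (θ a φ).sin)

lemma abs_circ_le_one (θ : ι → S → Real.Angle) (k : ι ⊕ ι) (φ : S) : |circ θ k φ| ≤ 1 := by
  cases k
  · exact abs_angle_cos_le_one _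
  · exact abs_angle_sin_le_one _

lemma bddMeas_circ {θ : ι → S → Real.Angle} (hθ : ∀ a, Measurable (θ a)) (k : ι ⊕ ι) :
    BddMeas (circ θ k) := by
  refine ⟨?_, 1, abs_circ_le_one θ k⟩
  cases k with
  | inl a => exact measurable_angle_cos.comp (hθ a)
  | inr a => exact measurable_angle_sin.comp (hθ a)

/-- The cosine and sine of a phase have the same amplitude, so the quadratic correction does not
depend on the configuration, and the likelihood is a constant times the Boltzmann weight. -/
lemma gWeight_circ (θ : ι → S → Real.Angle) (s : ι → ℝ) (ω : ι → ℝ × ℝ) (φ : S) :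
    gWeight (circ θ) (Sum.elim s s) (flatten ω) φ
      = Real.exp (-∑ a, s a ^ 2 / 2) * Real.exp (-potential s θ ω φ) := by
  rw [gWeight, ← Real.exp_add]
  congr 1
  simp only [Fintype.sum_sum_type, Sum.elim_inl, Sum.elim_inr, flatten_inl, flatten_inr, circ,
    potential, neg_neg, ← Finset.sum_neg_distrib, ← Finset.sum_add_distrib]
  refine Finset.sum_congr rfl fun a _ => ?_
  linear_combination (-(s a) ^ 2 / 2) * Real.Angle.cos_sq_add_sin_sq (θ a φ)

variable (ρ : Measure S)

lemma gInt_circ (θ : ι → S → Real.Angle) (s : ι → ℝ) (f : S → ℝ) (ω : ι → ℝ × ℝ) :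
    gInt ρ (circ θ) (Sum.elim s s) f (flatten ω)
      = Real.exp (-∑ a, s a ^ 2 / 2) * ∫ φ, f φ * Real.exp (-potential s θ ω φ) ∂ρ := by
  rw [gInt, ← integral_const_mul]
  refine integral_congr_ae (ae_of_all _ fun φ => ?_)
  simp only [gWeight_circ]
  ring

lemma gInt_circ_one (θ : ι → S → Real.Angle) (s : ι → ℝ) (ω : ι → ℝ × ℝ) :
    gInt ρ (circ θ) (Sum.elim s s) (fun _ => 1) (flatten ω)
      = Real.exp (-∑ a, s a ^ 2 / 2) * partitionFn ρ s θ ω := by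
  simp [gInt_circ, partitionFn]

lemma thermalAvg_eq_gInt_div (θ : ι → S → Real.Angle) (s : ι → ℝ) (ω : ι → ℝ × ℝ)
    (f : S → ℝ) : thermalAvg ρ s θ ω f
      = gInt ρ (circ θ) (Sum.elim s s) f (flatten ω)
        / gInt ρ (circ θ) (Sum.elim s s) (fun _ => 1) (flatten ω) := by
  rw [gInt_circ, gInt_circ_one, mul_div_mul_left _ _ (Real.exp_pos _).ne', thermalAvg]

variable [IsFiniteMeasure ρ] {θ : ι → S → Real.Angle}

section WellDefined

variable [NeZero ρ]

lemma partitionFn_pos (hθ : ∀ a, Measurable (θ a)) (s : ι → ℝ) (ω : ι → ℝ × ℝ) :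
    0 < partitionFn ρ s θ ω := by
  have := gInt_one_pos ρ (bddMeas_circ hθ) (Sum.elim s s) (flatten ω)
  rw [gInt_circ_one] at this
  exact pos_of_mul_pos_right this (Real.exp_pos _).le

lemma log_partitionFn (hθ : ∀ a, Measurable (θ a)) (s : ι → ℝ) (ω : ι → ℝ × ℝ) :
    Real.log (partitionFn ρ s θ ω)
      = Real.log (gInt ρ (circ θ) (Sum.elim s s) (fun _ => 1) (flatten ω))
        + ∑ a, s a ^ 2 / 2 := by
  rw [gInt_circ_one, Real.log_mul (Real.exp_pos _).ne' (partitionFn_pos ρ hθ s ω).ne',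
    Real.log_exp]
  ring

omit [NeZero ρ] in
lemma measurable_partitionFn (hθ : ∀ a, Measurable (θ a)) (s : ι → ℝ) :
    Measurable (partitionFn ρ s θ) := by
  have h : partitionFn ρ s θ = fun ω => (Real.exp (-∑ a, s a ^ 2 / 2))⁻¹
      * gInt ρ (circ θ) (Sum.elim s s) (fun _ => 1) (flatten ω) := by
    funext ω
    rw [gInt_circ_one, inv_mul_cancel_left₀ (Real.exp_pos _).ne']
  rw [h]
  exact ((measurable_gInt ρ (bddMeas_circ hθ) _ (.const 1)).comp flatten.measurable).const_mul _

omit [NeZero ρ] in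
lemma measurable_thermalAvg (hθ : ∀ a, Measurable (θ a)) (s : ι → ℝ) {f : S → ℝ}
    (hf : BddMeas f) : Measurable fun ω => thermalAvg ρ s θ ω f := by
  simp only [thermalAvg_eq_gInt_div]
  exact ((measurable_gInt ρ (bddMeas_circ hθ) _ hf).comp flatten.measurable).div
    ((measurable_gInt ρ (bddMeas_circ hθ) _ (.const 1)).comp flatten.measurable)

omit [NeZero ρ] in
lemma thermalAvg_add (hθ : ∀ a, Measurable (θ a)) (s : ι → ℝ) (ω : ι → ℝ × ℝ) {f g : S → ℝ}
    (hf : BddMeas f) (hg : BddMeas g) :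
    thermalAvg ρ s θ ω (fun φ => f φ + g φ) = thermalAvg ρ s θ ω f + thermalAvg ρ s θ ω g := by
  simp only [thermalAvg_eq_gInt_div, ← add_div]
  congr 1
  simp only [gInt, add_mul]
  exact integral_add (integrable_mul_gWeight ρ (bddMeas_circ hθ) _ _ hf)
    (integrable_mul_gWeight ρ (bddMeas_circ hθ) _ _ hg)

lemma abs_thermalAvg_le (hθ : ∀ a, Measurable (θ a)) (s : ι → ℝ) (ω : ι → ℝ × ℝ) {f : S → ℝ}
    {K : ℝ} (hK : ∀ φ, |f φ| ≤ K) : |thermalAvg ρ s θ ω f| ≤ K := by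
  have h0 := gInt_one_pos ρ (bddMeas_circ hθ) (Sum.elim s s) (flatten ω)
  rw [thermalAvg_eq_gInt_div, abs_div, abs_of_pos h0, div_le_iff₀ h0]
  exact abs_gInt_le ρ (bddMeas_circ hθ) _ _ hK

lemma integrable_thermalAvg (hθ : ∀ a, Measurable (θ a)) (s : ι → ℝ) {f : S → ℝ}
    (hf : BddMeas f) (P : Measure (ι → ℝ × ℝ)) [IsFiniteMeasure P] :
    Integrable (fun ω => thermalAvg ρ s θ ω f) P := by
  obtain ⟨K, hK⟩ := hf.bdd
  exact Integrable.of_bound (measurable_thermalAvg ρ hθ s hf).aestronglyMeasurable K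
    (ae_of_all _ fun ω => abs_thermalAvg_le ρ hθ s ω hK)

lemma exists_abs_elim_le (s : ι → ℝ) : ∃ R, ∀ k : ι ⊕ ι, |Sum.elim s s k| ≤ R := by
  refine ⟨∑ a, |s a|, fun k => ?_⟩
  have h : ∀ a, |s a| ≤ ∑ a, |s a| := fun a =>
    Finset.single_le_sum (f := fun a => |s a|) (fun _ _ => abs_nonneg _) (Finset.mem_univ a)
  cases k <;> exact h _

lemma integrable_log_partitionFn (hθ : ∀ a, Measurable (θ a)) (s D : ι → ℝ) (σ : ι → ℝ≥0) :
    Integrable (fun ω => Real.log (partitionFn ρ s θ ω)) (disorder D σ) := by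
  have hm : Measurable fun ω => Real.log (partitionFn ρ s θ ω) :=
    (measurable_partitionFn ρ hθ s).log
  have hT := measurePreserving_disorder D σ
  rw [← hT.map_eq, integrable_map_measure hm.aestronglyMeasurable hT.measurable.aemeasurable]
  obtain ⟨R, hR⟩ := exists_abs_elim_le s
  obtain ⟨C, c, hC, hc, hb⟩ := expBounded_log_gInt_one (T := Unit) ρ (s := fun _ => Sum.elim s s)
    (fun _ => hR) (bddMeas_circ hθ) (abs_circ_le_one θ)
  let L := ∑ a, |s a ^ 2 / 2|
  let E := ∑ a, |D a|
  let M := ∑ a, (σ a : ℝ)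
  have hM : ∀ a, (σ a : ℝ) ≤ M := fun a =>
    Finset.single_le_sum (f := fun a => (σ a : ℝ)) (fun _ _ => NNReal.coe_nonneg _)
      (Finset.mem_univ a)
  -- The disorder is an affine image of standard noise, so an exponential bound in it is an
  -- exponential bound in the noise with rate enlarged by `M`.
  have hsum : ∀ ω : ι → ℝ × ℝ, absSum (flatten fun a => (D a + σ a * (ω a).1, σ a * (ω a).2))
      ≤ E + M * absSum (flatten ω) := by
    intro ω
    simp only [absSum, Fintype.sum_sum_type, flatten_inl, flatten_inr, E, mul_add,
      Finset.mul_sum]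
    simp only [← Finset.sum_add_distrib]
    refine Finset.sum_le_sum fun a _ => ?_
    have h1 := abs_add_le (D a) (σ a * (ω a).1)
    have h2 := mul_le_mul_of_nonneg_right (hM a) (abs_nonneg (ω a).1)
    have h3 := mul_le_mul_of_nonneg_right (hM a) (abs_nonneg (ω a).2)
    rw [abs_mul, NNReal.abs_eq] at h1
    rw [abs_mul (σ a : ℝ) (ω a).2, NNReal.abs_eq]
    linarith
  have hint : Integrable (fun ω => C * Real.exp (c * E) *
      Real.exp (c * M * absSum (flatten ω)) + L) (stdDisorder ι) :=
    (((measurePreserving_flatten (ι := ι)).integrable_comp_emb flatten.measurableEmbedding).2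
      ((integrable_exp_absSum (c * M)).const_mul (C * Real.exp (c * E)))).add
      (integrable_const L)
  refine hint.mono' (hm.comp hT.measurable).aestronglyMeasurable (ae_of_all _ fun ω => ?_)
  simp only [Function.comp_apply]
  rw [log_partitionFn ρ hθ, Real.norm_eq_abs]
  refine (abs_add_le _ _).trans (add_le_add ((hb () _).trans ?_) (Finset.abs_sum_le_sum_abs _ _))
  rw [mul_assoc, ← Real.exp_add]
  refine mul_le_mul_of_nonneg_left (Real.exp_le_exp.2 ?_) hC
  have := mul_le_mul_of_nonneg_left (hsum ω) hc
  linarith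

end WellDefined

section Group

variable [AddCommGroup S] [MeasurableAdd S] [ρ.IsAddLeftInvariant]

lemma phase_zero (hadd : ∀ a x y, θ a (x + y) = θ a x + θ a y) (a : ι) : θ a 0 = 0 := by
  simpa using hadd a 0 0

/-- Only scalar products of the pair `(J, K)` with the unit vector of angle `θ` enter the weight.
Rotating the pair by `θ a x` and the configuration by `x` turns both vectors by the same angle,
because the phases are additive. -/
lemma gWeight_rotate (hadd : ∀ a x y, θ a (x + y) = θ a x + θ a y) (s : ι → ℝ)
    (ω : ι → ℝ × ℝ) (x y : S) :
    gWeight (circ θ) (Sum.elim s s) (flatten (rotate (fun a => θ a x) ω)) (x + y)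
      = gWeight (circ θ) (Sum.elim s s) (flatten ω) y := by
  rw [gWeight_circ, gWeight_circ]
  congr 3
  simp only [potential, rotate, hadd, Real.Angle.cos_add, Real.Angle.sin_add]
  congr 1
  refine Finset.sum_congr rfl fun a _ => ?_
  linear_combination s a * ((ω a).1 * (θ a y).cos + (ω a).2 * (θ a y).sin)
    * Real.Angle.cos_sq_add_sin_sq (θ a x)

lemma gInt_rotate (hadd : ∀ a x y, θ a (x + y) = θ a x + θ a y) (s : ι → ℝ) (f : S → ℝ)
    (ω : ι → ℝ × ℝ) (x : S) :
    gInt ρ (circ θ) (Sum.elim s s) f (flatten (rotate (fun a => θ a x) ω))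
      = gInt ρ (circ θ) (Sum.elim s s) (fun y => f (x + y)) (flatten ω) := by
  rw [gInt, ← integral_add_left_eq_self _ x]
  simp only [gWeight_rotate hadd, gInt]

/-- On the Nishimori line, the average over the disorder weighted with the partition function is
the average over the disorder planted at the ordered configuration. -/
lemma integral_gWeight_mul_eq_planted (hθ : ∀ a, Measurable (θ a))
    (hadd : ∀ a x y, θ a (x + y) = θ a x + θ a y) (s : ι → ℝ) {g : S → (ι ⊕ ι → ℝ) → ℝ}
    (hg : Measurable (Function.uncurry g)) (hb : ExpBounded g)
    (hinv : ∀ x ω, g x (flatten (rotate (fun a => θ a x) ω)) = g 0 (flatten ω)) :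
    ∫ ω, ∫ φ, gWeight (circ θ) (Sum.elim s s) ω φ * g φ ω ∂ρ ∂stdGaussianPi (ι ⊕ ι)
      = ρ.real Set.univ * ∫ ω, g 0 (flatten (ω + shift s)) ∂stdDisorder ι := by
  have hc := bddMeas_circ hθ
  have hm : Measurable fun p : (ι ⊕ ι → ℝ) × S =>
      gWeight (circ θ) (Sum.elim s s) p.1 p.2 * g p.2 p.1 :=
    (measurable_gWeight_uncurry (fun k => (hc k).measurable) _).mul (hg.comp measurable_swap)
  obtain ⟨R, hR⟩ := exists_abs_elim_le s
  obtain ⟨C, c, hC, -, hgb⟩ := hb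
  have hint : Integrable (fun p : (ι ⊕ ι → ℝ) × S =>
      gWeight (circ θ) (Sum.elim s s) p.1 p.2 * g p.2 p.1) ((stdGaussianPi (ι ⊕ ι)).prod ρ) := by
    have hi := ((integrable_exp_absSum (κ := ι ⊕ ι) (R + c)).const_mul
      (Real.exp (Fintype.card (ι ⊕ ι) * (R ^ 2 / 2)) * C)).comp_fst ρ
    refine hi.mono' hm.aestronglyMeasurable (ae_of_all _ fun p => ?_)
    rw [Real.norm_eq_abs, abs_mul, abs_of_pos (gWeight_pos _ _ _ _)]
    have h1 : gWeight (circ θ) (Sum.elim s s) p.1 p.2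
        ≤ Real.exp (R * absSum p.1 + Fintype.card (ι ⊕ ι) * (R ^ 2 / 2)) :=
      Real.exp_le_exp.2 ((le_abs_self _).trans (abs_exponent_le hR (abs_circ_le_one θ) p.1 p.2))
    refine (mul_le_mul h1 (hgb p.2 p.1) (abs_nonneg _) (Real.exp_pos _).le).trans (le_of_eq ?_)
    rw [Real.exp_add, add_mul, Real.exp_add]
    ring
  rw [integral_integral_swap hint]
  -- For each planted `x`, rotating the noise sends its weight to that of the configuration `0`,
  -- where all cosines are `1` and all sines `0`. That weight is the Cameron-Martin density of the
  -- shift by `s` in the cosine components. The result does not depend on `x`, so the integral over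
  -- `x` contributes the total mass.
  have key : ∀ x, ∫ ω, gWeight (circ θ) (Sum.elim s s) ω x * g x ω ∂stdGaussianPi (ι ⊕ ι)
      = ∫ ω, g 0 (flatten (ω + shift s)) ∂stdDisorder ι := by
    intro x
    have hw : ∀ ω, gWeight (circ θ) (Sum.elim s s) (flatten (rotate (fun a => θ a x) ω)) x
        = Real.exp (∑ k, (Sum.elim s 0 k * flatten ω k - Sum.elim s 0 k ^ 2 / 2)) := by
      intro ω
      have := gWeight_rotate hadd s ω x 0
      rw [add_zero] at this
      rw [this, gWeight]
      congr 1
      simp [circ, phase_zero hadd]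
    rw [← integral_comp_flatten (fun ω => gWeight (circ θ) (Sum.elim s s) ω x * g x ω),
      ← integral_comp_rotate (fun a => θ a x)]
    simp only [hw, hinv]
    rw [integral_comp_flatten (fun ω =>
      Real.exp (∑ k, (Sum.elim s 0 k * ω k - Sum.elim s 0 k ^ 2 / 2)) * g 0 ω),
      ← integral_add_stdGaussianPi, ← integral_comp_flatten]
    simp only [flatten_add_shift]
  simp only [key, integral_const, smul_eq_mul]

variable [NeZero ρ]

/-- The observable `log W` is gauge invariant and independent of the planted configuration, so
integrating the weight in the planting identity produces `W log W`. -/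
lemma integral_entropy_eq_planted (hθ : ∀ a, Measurable (θ a))
    (hadd : ∀ a x y, θ a (x + y) = θ a x + θ a y) (s : ι → ℝ) :
    ∫ ω, gInt ρ (circ θ) (Sum.elim s s) (fun _ => 1) ω
        * Real.log (gInt ρ (circ θ) (Sum.elim s s) (fun _ => 1) ω) ∂stdGaussianPi (ι ⊕ ι)
      = ρ.real Set.univ * ∫ ω, Real.log (gInt ρ (circ θ) (Sum.elim s s) (fun _ => 1)
          (flatten (ω + shift s))) ∂stdDisorder ι := by
  have hc := bddMeas_circ hθ
  obtain ⟨R, hR⟩ := exists_abs_elim_le s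
  rw [← integral_gWeight_mul_eq_planted ρ hθ hadd s
    (g := fun _ ω => Real.log (gInt ρ (circ θ) (Sum.elim s s) (fun _ => 1) ω))
    ((measurable_gInt ρ hc _ (.const 1)).log.comp measurable_snd)
    (expBounded_log_gInt_one ρ (s := fun _ => Sum.elim s s) (fun _ => hR) hc (abs_circ_le_one θ))
    (fun x ω => by rw [gInt_rotate ρ hadd])]
  simp only [integral_mul_const]
  simp only [gInt, one_mul]

/-- The Nishimori identity: the overlap of two replicas has the same mean as the magnetization.
Under the planted law one replica may be taken to be the planted configuration, which is then
rotated to `0`. -/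
lemma integral_overlap_eq_planted (hθ : ∀ a, Measurable (θ a))
    (hadd : ∀ a x y, θ a (x + y) = θ a x + θ a y) (s : ι → ℝ) (a : ι) :
    (∫ ω, gInt ρ (circ θ) (Sum.elim s s) (circ θ (.inl a)) ω ^ 2
        * (gInt ρ (circ θ) (Sum.elim s s) (fun _ => 1) ω)⁻¹ ∂stdGaussianPi (ι ⊕ ι))
      + (∫ ω, gInt ρ (circ θ) (Sum.elim s s) (circ θ (.inr a)) ω ^ 2
        * (gInt ρ (circ θ) (Sum.elim s s) (fun _ => 1) ω)⁻¹ ∂stdGaussianPi (ι ⊕ ι))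
      = ρ.real Set.univ * ∫ ω, thermalAvg ρ s θ (ω + shift s) (fun φ => (θ a φ).cos)
          ∂stdDisorder ι := by
  have hc := bddMeas_circ hθ
  obtain ⟨R, hR⟩ := exists_abs_elim_le s
  set X : (S → ℝ) → (ι ⊕ ι → ℝ) → ℝ := fun f => gInt ρ (circ θ) (Sum.elim s s) f with hX
  have mX : ∀ {f : S → ℝ}, BddMeas f → Measurable (X f) := fun hf => measurable_gInt ρ hc _ hf
  have bX : ∀ {f : S → ℝ}, BddMeas f → ExpBounded fun _ : S => X f := fun hf =>
    expBounded_gInt ρ (s := fun _ => Sum.elim s s) (fun _ => hR) hc (abs_circ_le_one θ) hf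
  have bI : ExpBounded fun (_ : S) ω => (X (fun _ => 1) ω)⁻¹ :=
    expBounded_inv_gInt_one ρ (s := fun _ => Sum.elim s s) (fun _ => hR) hc (abs_circ_le_one θ)
  have bk : ∀ k, ExpBounded fun (φ : S) (_ : ι ⊕ ι → ℝ) => circ θ k φ := fun k =>
    ExpBounded.of_bounded (abs_circ_le_one θ k)
  -- The thermal average of `cos (θ φ - θ ψ)` over `ψ`, which is invariant under a simultaneous
  -- rotation of `φ` and the disorder.
  let g : S → (ι ⊕ ι → ℝ) → ℝ := fun φ ω => (circ θ (.inl a) φ * X (circ θ (.inl a)) ω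
    + circ θ (.inr a) φ * X (circ θ (.inr a)) ω) * (X (fun _ => 1) ω)⁻¹
  have hgm : Measurable (Function.uncurry g) := by
    have h1 : ∀ k, Measurable fun p : S × (ι ⊕ ι → ℝ) => circ θ k p.1 := fun k =>
      (hc k).measurable.comp measurable_fst
    have h2 : ∀ k, Measurable fun p : S × (ι ⊕ ι → ℝ) => X (circ θ k) p.2 := fun k =>
      (mX (hc k)).comp measurable_snd
    have h3 : Measurable fun p : S × (ι ⊕ ι → ℝ) => X (fun _ => 1) p.2 :=
      (mX (.const 1)).comp measurable_snd
    exact (((h1 _).mul (h2 _)).add ((h1 _).mul (h2 _))).mul h3.inv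
  have hgb : ExpBounded g := (((bk _).mul (bX (hc _))).add ((bk _).mul (bX (hc _)))).mul bI
  have hcomb : ∀ x ω, circ θ (.inl a) x * X (circ θ (.inl a)) ω
      + circ θ (.inr a) x * X (circ θ (.inr a)) ω
      = X (fun φ => circ θ (.inl a) x * circ θ (.inl a) φ
        + circ θ (.inr a) x * circ θ (.inr a) φ) ω := by
    intro x ω
    simp only [hX, gInt, ← integral_const_mul]
    rw [← integral_add ((integrable_mul_gWeight ρ hc _ ω (hc _)).const_mul _)
      ((integrable_mul_gWeight ρ hc _ ω (hc _)).const_mul _)]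
    exact integral_congr_ae (ae_of_all _ fun φ => by simp only; ring)
  have hg0 : ∀ ω, g 0 ω = X (circ θ (.inl a)) ω * (X (fun _ => 1) ω)⁻¹ := by
    intro ω
    simp [g, circ, phase_zero hadd]
  have hinv : ∀ x ω, g x (flatten (rotate (fun a => θ a x) ω)) = g 0 (flatten ω) := by
    intro x ω
    rw [hg0]
    simp only [g, hcomb]
    simp only [hX, gInt_rotate ρ hadd]
    congr 2
    funext y
    simp only [circ, Sum.elim_inl, Sum.elim_inr, hadd, Real.Angle.cos_add, Real.Angle.sin_add]
    linear_combination (θ a y).cos * Real.Angle.cos_sq_add_sin_sq (θ a x)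
  have h := integral_gWeight_mul_eq_planted ρ hθ hadd s hgm hgb hinv
  have hlhs : ∀ ω, ∫ φ, gWeight (circ θ) (Sum.elim s s) ω φ * g φ ω ∂ρ
      = X (circ θ (.inl a)) ω ^ 2 * (X (fun _ => 1) ω)⁻¹
        + X (circ θ (.inr a)) ω ^ 2 * (X (fun _ => 1) ω)⁻¹ := by
    intro ω
    have e : ∀ φ, gWeight (circ θ) (Sum.elim s s) ω φ * g φ ω
        = (circ θ (.inl a) φ * gWeight (circ θ) (Sum.elim s s) ω φ)
            * (X (circ θ (.inl a)) ω * (X (fun _ => 1) ω)⁻¹)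
          + (circ θ (.inr a) φ * gWeight (circ θ) (Sum.elim s s) ω φ)
            * (X (circ θ (.inr a)) ω * (X (fun _ => 1) ω)⁻¹) := fun φ => by
      simp only [g]; ring
    simp only [e]
    rw [integral_add ((integrable_mul_gWeight ρ hc _ ω (hc _)).mul_const _)
      ((integrable_mul_gWeight ρ hc _ ω (hc _)).mul_const _), integral_mul_const,
      integral_mul_const]
    simp only [hX, gInt]
    ring
  have hi : ∀ k, Integrable (fun ω => X (circ θ k) ω ^ 2 * (X (fun _ => 1) ω)⁻¹)
      (stdGaussianPi (ι ⊕ ι)) := fun k =>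
    (((bX (hc k)).pow 2).mul bI).integrable 0 (((mX (hc k)).pow_const 2).mul (mX (.const 1)).inv)
  rw [← integral_add (hi _) (hi _)]
  simp only [hlhs] at h
  rw [h]
  congr 1
  refine integral_congr_ae (ae_of_all _ fun ω => ?_)
  simp only [hg0, thermalAvg_eq_gInt_div, div_eq_mul_inv]
  rfl

/-- The planted pressure lies above its tangents. -/
theorem planted_pressure_tangent_le (hθ : ∀ a, Measurable (θ a))
    (hadd : ∀ a x y, θ a (x + y) = θ a x + θ a y) (s r : ι → ℝ) (hsr : ∀ a, s a * r a = 0) :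
    (∫ ω, Real.log (partitionFn ρ r θ (ω + shift r)) ∂stdDisorder ι)
      + 1 / 2 * ∑ a, (s a ^ 2 - r a ^ 2)
        * (1 + ∫ ω, thermalAvg ρ r θ (ω + shift r) (fun φ => (θ a φ).cos) ∂stdDisorder ι)
    ≤ ∫ ω, Real.log (partitionFn ρ s θ (ω + shift s)) ∂stdDisorder ι := by
  classical
  have hc := bddMeas_circ hθ
  have h := entropy_tangent_le ρ hc (abs_circ_le_one θ) (Sum.elim s s) (Sum.elim r r)
    (by rintro (a | a) <;> exact hsr a)
  simp only [Fintype.sum_sum_type, Sum.elim_inl, Sum.elim_inr] at h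
  rw [← Finset.sum_add_distrib] at h
  simp only [← mul_add, integral_overlap_eq_planted ρ hθ hadd,
    integral_entropy_eq_planted ρ hθ hadd] at h
  have hlog : ∀ q : ι → ℝ, ∫ ω, Real.log (partitionFn ρ q θ (ω + shift q)) ∂stdDisorder ι
      = (∫ ω, Real.log (gInt ρ (circ θ) (Sum.elim q q) (fun _ => 1)
          (flatten (ω + shift q))) ∂stdDisorder ι) + ∑ a, q a ^ 2 / 2 := by
    intro q
    obtain ⟨R, hR⟩ := exists_abs_elim_le q
    have hi : Integrable (fun ω => Real.log (gInt ρ (circ θ) (Sum.elim q q) (fun _ => 1)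
          (flatten (ω + shift q)))) (stdDisorder ι) := by
      obtain ⟨C, c, hC, hc0, hb⟩ := expBounded_log_gInt_one (T := Unit) ρ
        (s := fun _ => Sum.elim q q) (fun _ => hR) hc (abs_circ_le_one θ)
      have hb' : ExpBounded fun (_ : Unit) (ω : ι ⊕ ι → ℝ) => Real.log
          (gInt ρ (circ θ) (Sum.elim q q) (fun _ => 1) (ω + Sum.elim q 0)) := by
        refine ⟨C * Real.exp (c * absSum (Sum.elim q (0 : ι → ℝ))), c, by positivity, hc0, fun t ω => ?_⟩
        refine (hb () _).trans ?_
        rw [mul_assoc, ← Real.exp_add]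
        refine mul_le_mul_of_nonneg_left (Real.exp_le_exp.2 ?_) hC
        have := mul_le_mul_of_nonneg_left (absSum_add_le ω (Sum.elim q (0 : ι → ℝ))) hc0
        linarith
      have := hb'.integrable () ((measurable_gInt ρ hc _ (.const 1)).log.comp
        (measurable_id.add_const _))
      have := (measurePreserving_flatten.integrable_comp_emb flatten.measurableEmbedding).2 this
      simpa only [flatten_add_shift, Function.comp_def] using this
    simp only [log_partitionFn ρ hθ]
    rw [integral_add hi (integrable_const _)]
    simp
  rw [hlog, hlog]
  have hρ : 0 < ρ.real Set.univ := by
    rw [measureReal_def]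
    exact ENNReal.toReal_pos (by simpa using NeZero.ne ρ) (measure_ne_top _ _)
  -- The summand `1` in `1 + u a` comes from the normalizations `q²/2` that separate `log Z` from
  -- the logarithm of the likelihood.
  have hsum : ∀ u : ι → ℝ, 1 / 2 * ∑ a, (s a ^ 2 - r a ^ 2) * (1 + u a)
      = ∑ a, s a ^ 2 / 2 - ∑ a, r a ^ 2 / 2 + 1 / 2 * ∑ a, (s a ^ 2 - r a ^ 2) * u a := by
    intro u
    simp only [mul_add, Finset.sum_add_distrib, Finset.mul_sum, mul_one, mul_sub,
      Finset.sum_sub_distrib, div_eq_inv_mul]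
  rw [hsum]
  have hfac : ∀ u : ι → ℝ, 1 / 2 * ∑ a, (s a ^ 2 - r a ^ 2) * (ρ.real Set.univ * u a)
      = ρ.real Set.univ * (1 / 2 * ∑ a, (s a ^ 2 - r a ^ 2) * u a) := by
    intro u
    simp only [Finset.mul_sum]
    exact Finset.sum_congr rfl fun a _ => by ring
  rw [hfac, ← mul_add] at h
  have := le_of_mul_le_mul_left h hρ
  linarith

end Group

end Gauge

/-! ### The Gibbs-Bogoliubov inequality for two independent random potentials -/

section Restriction

variable {ι₁ ι₂ : Type*} [Fintype ι₁] [Fintype ι₂]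

lemma measurePreserving_comp_inl :
    MeasurePreserving (fun (ω : ι₁ ⊕ ι₂ → ℝ × ℝ) a => ω (.inl a)) (stdDisorder (ι₁ ⊕ ι₂))
      (stdDisorder ι₁) :=
  (measurePreserving_fst (μ := stdDisorder ι₁) (ν := stdDisorder ι₂)).comp
    (measurePreserving_sumPiEquivProdPi fun _ : ι₁ ⊕ ι₂ =>
      (gaussianReal 0 1).prod (gaussianReal 0 1))

lemma measurePreserving_comp_inr :
    MeasurePreserving (fun (ω : ι₁ ⊕ ι₂ → ℝ × ℝ) a => ω (.inr a)) (stdDisorder (ι₁ ⊕ ι₂))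
      (stdDisorder ι₂) :=
  (measurePreserving_snd (μ := stdDisorder ι₁) (ν := stdDisorder ι₂)).comp
    (measurePreserving_sumPiEquivProdPi fun _ : ι₁ ⊕ ι₂ =>
      (gaussianReal 0 1).prod (gaussianReal 0 1))

end Restriction

lemma integral_comp_measurePreserving {α β : Type*} [MeasurableSpace α] [MeasurableSpace β]
    {P : Measure α} {Q : Measure β} {T : α → β} (hT : MeasurePreserving T P Q) {h : β → ℝ}
    (hm : Measurable h) : ∫ x, h (T x) ∂P = ∫ y, h y ∂Q := by
  rw [← hT.map_eq, integral_map hT.measurable.aemeasurable hm.aestronglyMeasurable]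

section PotentialCongr

variable {ι ι' S : Type*} [Fintype ι] [Fintype ι'] [MeasurableSpace S] (ρ : Measure S)
  {β : ι → ℝ} {θ : ι → S → Real.Angle} {ω : ι → ℝ × ℝ}
  {β' : ι' → ℝ} {θ' : ι' → S → Real.Angle} {ω' : ι' → ℝ × ℝ}

lemma partitionFn_congr (h : potential β θ ω = potential β' θ' ω') :
    partitionFn ρ β θ ω = partitionFn ρ β' θ' ω' := by
  simp only [partitionFn, h]

lemma thermalAvg_congr (h : potential β θ ω = potential β' θ' ω') (f : S → ℝ) :
    thermalAvg ρ β θ ω f = thermalAvg ρ β' θ' ω' f := by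
  simp only [thermalAvg, partitionFn, h]

end PotentialCongr

/-! ### The Nishimori line as planting at the configuration `0`. -/

section Nishimori

variable {ι S : Type*} [Fintype ι] [MeasurableSpace S] (ρ : Measure S) [IsFiniteMeasure ρ]
  {θ : ι → S → Real.Angle} {β D : ι → ℝ} {σ : ι → ℝ≥0}

/-- With `D = βσ²` one has `β(D + σJ) = βσ(J + βσ)`, so the shift of the standard noise equals the
amplitude multiplying it. -/
lemma potential_nishimori (hNL : ∀ a, D a = β a * (σ a : ℝ) ^ 2) (ω : ι → ℝ × ℝ) :
    potential β θ (fun a => (D a + σ a * (ω a).1, σ a * (ω a).2))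
      = potential (fun a => β a * σ a) θ (ω + shift fun a => β a * σ a) := by
  funext φ
  simp only [potential, shift, Pi.add_apply, Prod.fst_add, Prod.snd_add, add_zero, hNL]
  congr 1
  exact Finset.sum_congr rfl fun a _ => by ring

lemma pressure_eq_planted (hθ : ∀ a, Measurable (θ a))
    (hNL : ∀ a, D a = β a * (σ a : ℝ) ^ 2) :
    pressure ρ β D σ θ = ∫ ω, Real.log (partitionFn ρ (fun a => β a * σ a) θ
      (ω + shift fun a => β a * σ a)) ∂stdDisorder ι := by
  rw [pressure, ← integral_comp_measurePreserving (measurePreserving_disorder D σ)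
    (measurable_partitionFn ρ hθ β).log]
  simp only [partitionFn_congr ρ (potential_nishimori hNL _)]

lemma integral_thermalAvg_eq_planted (hθ : ∀ a, Measurable (θ a))
    (hNL : ∀ a, D a = β a * (σ a : ℝ) ^ 2) {f : S → ℝ} (hf : BddMeas f) :
    ∫ ω, thermalAvg ρ β θ ω f ∂disorder D σ = ∫ ω, thermalAvg ρ (fun a => β a * σ a) θ
      (ω + shift fun a => β a * σ a) f ∂stdDisorder ι := by
  rw [← integral_comp_measurePreserving (measurePreserving_disorder D σ)
    (measurable_thermalAvg ρ hθ β hf)]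
  simp only [thermalAvg_congr ρ (potential_nishimori hNL _)]

end Nishimori

section GibbsBogoliubov

variable {ι₁ ι₂ S : Type*} [Fintype ι₁] [Fintype ι₂] [MeasurableSpace S] (ρ : Measure S)
  [IsFiniteMeasure ρ] [NeZero ρ] [AddCommGroup S] [MeasurableAdd S] [ρ.IsAddLeftInvariant]
  {θ₁ : ι₁ → S → Real.Angle} {β₁ D₁ : ι₁ → ℝ} {σ₁ : ι₁ → ℝ≥0}
  {θ₂ : ι₂ → S → Real.Angle} {β₂ D₂ : ι₂ → ℝ} {σ₂ : ι₂ → ℝ≥0}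

lemma bddMeas_cos {f : S → Real.Angle} (hf : Measurable f) : BddMeas fun φ => (f φ).cos :=
  ⟨measurable_angle_cos.comp hf, 1, fun _ => abs_angle_cos_le_one _⟩

lemma bddMeas_sin {f : S → Real.Angle} (hf : Measurable f) : BddMeas fun φ => (f φ).sin :=
  ⟨measurable_angle_sin.comp hf, 1, fun _ => abs_angle_sin_le_one _⟩

/-- The Gibbs-Bogoliubov inequality on the Nishimori line. -/
theorem gibbs_bogoliubov (hθ₁ : ∀ a, Measurable (θ₁ a)) (hθ₂ : ∀ a, Measurable (θ₂ a))
    (hadd₁ : ∀ a x y, θ₁ a (x + y) = θ₁ a x + θ₁ a y)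
    (hadd₂ : ∀ a x y, θ₂ a (x + y) = θ₂ a x + θ₂ a y)
    (hNL₁ : ∀ a, D₁ a = β₁ a * (σ₁ a : ℝ) ^ 2) (hNL₂ : ∀ a, D₂ a = β₂ a * (σ₂ a : ℝ) ^ 2) :
    pressure ρ β₂ D₂ σ₂ θ₂
      + 1 / 2 * ∑ a, β₁ a * D₁ a
          * (1 + ∫ ω, thermalAvg ρ β₂ θ₂ ω (fun φ => (θ₁ a φ).cos) ∂disorder D₂ σ₂)
      - 1 / 2 * ∑ a, β₂ a * D₂ a
          * (1 + ∫ ω, thermalAvg ρ β₂ θ₂ ω (fun φ => (θ₂ a φ).cos) ∂disorder D₂ σ₂)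
    ≤ pressure ρ β₁ D₁ σ₁ θ₁ := by
  set s₁ : ι₁ → ℝ := fun a => β₁ a * σ₁ a with hs₁
  set s₂ : ι₂ → ℝ := fun a => β₂ a * σ₂ a with hs₂
  let θ : ι₁ ⊕ ι₂ → S → Real.Angle := Sum.elim θ₁ θ₂
  have hθ : ∀ a, Measurable (θ a) := by rintro (a | a); exacts [hθ₁ a, hθ₂ a]
  have hadd : ∀ a x y, θ a (x + y) = θ a x + θ a y := by
    rintro (a | a); exacts [hadd₁ a, hadd₂ a]
  -- Both potentials live in one system, with disjoint sets of active terms so that the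
  -- orthogonality condition holds. The tangent point is the trial system.
  have h := planted_pressure_tangent_le ρ hθ hadd (Sum.elim s₁ 0) (Sum.elim 0 s₂)
    (by rintro (a | a) <;> simp)
  have hp₁ : ∀ ω, potential (Sum.elim s₁ 0) θ (ω + shift (Sum.elim s₁ 0))
      = potential s₁ θ₁ ((fun a => ω (.inl a)) + shift s₁) := by
    intro ω; funext φ
    simp [potential, shift, θ]
  have hp₂ : ∀ ω, potential (Sum.elim 0 s₂) θ (ω + shift (Sum.elim 0 s₂))
      = potential s₂ θ₂ ((fun a => ω (.inr a)) + shift s₂) := by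
    intro ω; funext φ
    simp [potential, shift, θ]
  have hm₁ : Measurable fun ω => Real.log (partitionFn ρ s₁ θ₁ (ω + shift s₁)) :=
    ((measurable_partitionFn ρ hθ₁ s₁).comp (measurable_id.add_const _)).log
  have hm₂ : Measurable fun ω => Real.log (partitionFn ρ s₂ θ₂ (ω + shift s₂)) :=
    ((measurable_partitionFn ρ hθ₂ s₂).comp (measurable_id.add_const _)).log
  have hm₂' : ∀ {f : S → ℝ}, BddMeas f →
      Measurable fun ω => thermalAvg ρ s₂ θ₂ (ω + shift s₂) f := fun hf =>
    (measurable_thermalAvg ρ hθ₂ s₂ hf).comp (measurable_id.add_const _)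
  -- Terms of zero amplitude do not enter the potential, so their disorder integrates out.
  have e₁ : ∫ ω, Real.log (partitionFn ρ (Sum.elim s₁ 0) θ (ω + shift (Sum.elim s₁ 0)))
      ∂stdDisorder (ι₁ ⊕ ι₂) = pressure ρ β₁ D₁ σ₁ θ₁ := by
    rw [pressure_eq_planted ρ hθ₁ hNL₁,
      ← integral_comp_measurePreserving (measurePreserving_comp_inl (ι₂ := ι₂)) hm₁]
    simp only [partitionFn_congr ρ (hp₁ _)]
  have e₂ : ∫ ω, Real.log (partitionFn ρ (Sum.elim 0 s₂) θ (ω + shift (Sum.elim 0 s₂)))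
      ∂stdDisorder (ι₁ ⊕ ι₂) = pressure ρ β₂ D₂ σ₂ θ₂ := by
    rw [pressure_eq_planted ρ hθ₂ hNL₂,
      ← integral_comp_measurePreserving (measurePreserving_comp_inr (ι₁ := ι₁)) hm₂]
    simp only [partitionFn_congr ρ (hp₂ _)]
  have e₃ : ∀ {f : S → ℝ}, BddMeas f →
      ∫ ω, thermalAvg ρ (Sum.elim 0 s₂) θ (ω + shift (Sum.elim 0 s₂)) f
      ∂stdDisorder (ι₁ ⊕ ι₂) = ∫ ω, thermalAvg ρ β₂ θ₂ ω f ∂disorder D₂ σ₂ := by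
    intro f hf
    rw [integral_thermalAvg_eq_planted ρ hθ₂ hNL₂ hf,
      ← integral_comp_measurePreserving (measurePreserving_comp_inr (ι₁ := ι₁)) (hm₂' hf)]
    simp only [thermalAvg_congr ρ (hp₂ _)]
  have e₄ : ∀ a, ∫ ω, thermalAvg ρ (Sum.elim 0 s₂) θ (ω + shift (Sum.elim 0 s₂))
      (fun φ => (θ a φ).cos) ∂stdDisorder (ι₁ ⊕ ι₂)
      = ∫ ω, thermalAvg ρ β₂ θ₂ ω (fun φ => (θ a φ).cos) ∂disorder D₂ σ₂ := fun a =>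
    e₃ (bddMeas_cos (hθ a))
  have q₁ : ∀ a, s₁ a ^ 2 = β₁ a * D₁ a := fun a => by rw [hNL₁]; simp only [hs₁]; ring
  have q₂ : ∀ a, s₂ a ^ 2 = β₂ a * D₂ a := fun a => by rw [hNL₂]; simp only [hs₂]; ring
  rw [e₁, e₂] at h
  simp only [e₄, Fintype.sum_sum_type, Sum.elim_inl, Sum.elim_inr, Pi.zero_apply, θ, q₁, q₂,
    ne_eq, OfNat.ofNat_ne_zero, not_false_eq_true, zero_pow, sub_zero, zero_sub, neg_mul,
    Finset.sum_neg_distrib] at h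
  linarith

end GibbsBogoliubov

/-! ### Independent sites -/

section Product

variable {Λ J X : Type*} [Fintype Λ] [Fintype J] [MeasurableSpace X]

/-- The disorder at the site `i`. -/
def atSite (ω : (Σ _ : Λ, J) → ℝ × ℝ) (i : Λ) : J → ℝ × ℝ := fun m => ω ⟨i, m⟩

lemma measurePreserving_atSite (D : J → ℝ) (σ : J → ℝ≥0) :
    MeasurePreserving (atSite (Λ := Λ)) (disorder (fun a : Σ _ : Λ, J => D a.2) fun a => σ a.2)
      (Measure.pi fun _ => disorder D σ) := by
  have h := Measure.infinitePi_map_piCurry (ι := Λ) (κ := fun _ => J) (X := fun _ _ => ℝ × ℝ)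
    fun _ m => (gaussianReal (D m) (σ m ^ 2)).prod (gaussianReal 0 (σ m ^ 2))
  simp only [Measure.infinitePi_eq_pi] at h
  exact ⟨(MeasurableEquiv.piCurry fun (_ : Λ) (_ : J) => ℝ × ℝ).measurable, h⟩

variable (μ : Measure X) (β : J → ℝ) (θ : J → X → Real.Angle)

/-- The phases of independent sites. -/
def siteTheta (Λ : Type*) {J X : Type*} (θ : J → X → Real.Angle) (a : Σ _ : Λ, J)
    (φ : Λ → X) : Real.Angle := θ a.2 (φ a.1)

lemma exp_neg_potential_sites (ω : (Σ _ : Λ, J) → ℝ × ℝ) (φ : Λ → X) :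
    Real.exp (-potential (fun a : Σ _ : Λ, J => β a.2) (siteTheta Λ θ) ω φ)
      = ∏ i, Real.exp (-potential β θ (atSite ω i) (φ i)) := by
  rw [← Real.exp_sum]
  simp only [potential, neg_neg, Fintype.sum_sigma, atSite, siteTheta]

variable [SigmaFinite μ]

lemma partitionFn_sites (ω : (Σ _ : Λ, J) → ℝ × ℝ) :
    partitionFn (Measure.pi fun _ : Λ => μ) (fun a : Σ _ : Λ, J => β a.2) (siteTheta Λ θ) ω
      = ∏ i, partitionFn μ β θ (atSite ω i) := by
  simp only [partitionFn, exp_neg_potential_sites]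
  exact integral_fintype_prod_eq_prod (μ := fun _ : Λ => μ)
    fun i x => Real.exp (-potential β θ (atSite ω i) x)

lemma thermalAvg_sites (ω : (Σ _ : Λ, J) → ℝ × ℝ) (g : Λ → X → ℝ) :
    thermalAvg (Measure.pi fun _ : Λ => μ) (fun a : Σ _ : Λ, J => β a.2) (siteTheta Λ θ) ω
      (fun φ => ∏ i, g i (φ i)) = ∏ i, thermalAvg μ β θ (atSite ω i) (g i) := by
  simp only [thermalAvg, partitionFn_sites, exp_neg_potential_sites, ← Finset.prod_mul_distrib,
    Finset.prod_div_distrib]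
  congr 1
  exact integral_fintype_prod_eq_prod (μ := fun _ : Λ => μ)
    fun i x => g i x * Real.exp (-potential β θ (atSite ω i) x)

variable [IsFiniteMeasure μ] [NeZero μ] {θ}

/-- Independence is used twice: the Gibbs measure is a product over sites for each disorder sample,
and the samples at different sites are independent with the same law. -/
lemma integral_thermalAvg_sites (D : J → ℝ) (σ : J → ℝ≥0) (hθ : ∀ m, Measurable (θ m))
    {g : Λ → X → ℝ} (hg : ∀ i, BddMeas (g i)) :
    ∫ ω, thermalAvg (Measure.pi fun _ : Λ => μ) (fun a : Σ _ : Λ, J => β a.2) (siteTheta Λ θ) ω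
        (fun φ => ∏ i, g i (φ i)) ∂disorder (fun a : Σ _ : Λ, J => D a.2) (fun a => σ a.2)
      = ∏ i, ∫ ω, thermalAvg μ β θ ω (g i) ∂disorder D σ := by
  simp only [thermalAvg_sites]
  have hm : Measurable fun η : Λ → J → ℝ × ℝ => ∏ i, thermalAvg μ β θ (η i) (g i) :=
    Finset.measurable_prod _ fun i _ =>
      (measurable_thermalAvg μ hθ β (hg i)).comp (measurable_pi_apply i)
  rw [integral_comp_measurePreserving (measurePreserving_atSite D σ) hm]
  exact integral_fintype_prod_eq_prod (μ := fun _ : Λ => disorder D σ)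
    fun i ω => thermalAvg μ β θ ω (g i)

lemma pressure_sites (D : J → ℝ) (σ : J → ℝ≥0) (hθ : ∀ m, Measurable (θ m)) :
    pressure (Measure.pi fun _ : Λ => μ) (fun a : Σ _ : Λ, J => β a.2) (fun a => D a.2)
      (fun a => σ a.2) (siteTheta Λ θ) = Fintype.card Λ * pressure μ β D σ θ := by
  have hm := (measurable_partitionFn μ hθ β).log
  have hT : ∀ i : Λ, MeasurePreserving (fun ω => atSite ω i)
      (disorder (fun a : Σ _ : Λ, J => D a.2) fun a => σ a.2) (disorder D σ) := fun i =>
    (measurePreserving_eval (fun _ : Λ => disorder D σ) i).comp (measurePreserving_atSite D σ)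
  simp only [pressure, partitionFn_sites]
  simp only [Real.log_prod fun i _ => (partitionFn_pos μ hθ β (atSite _ i)).ne']
  have hi : ∀ i : Λ, Integrable (fun ω => Real.log (partitionFn μ β θ (atSite ω i)))
      (disorder (fun a : Σ _ : Λ, J => D a.2) fun a => σ a.2) := fun i =>
    (hT i).integrable_comp_of_integrable (integrable_log_partitionFn μ hθ β D σ)
  rw [integral_finsetSum _ fun i _ => hi i]
  simp only [integral_comp_measurePreserving (hT _) hm]
  simp

lemma thermalAvg_one (hθ : ∀ m, Measurable (θ m)) (ω : J → ℝ × ℝ) :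
    thermalAvg μ β θ ω (fun _ => 1) = 1 := by
  simp only [thermalAvg, one_mul]
  exact div_self (partitionFn_pos μ hθ β ω).ne'

lemma integral_thermalAvg_one_site [DecidableEq Λ] (D : J → ℝ) (σ : J → ℝ≥0)
    (hθ : ∀ m, Measurable (θ m)) (i : Λ) {f : X → ℝ} (hf : BddMeas f) :
    ∫ ω, thermalAvg (Measure.pi fun _ : Λ => μ) (fun a : Σ _ : Λ, J => β a.2) (siteTheta Λ θ) ω
        (fun φ => f (φ i)) ∂disorder (fun a : Σ _ : Λ, J => D a.2) (fun a => σ a.2)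
      = ∫ ω, thermalAvg μ β θ ω f ∂disorder D σ := by
  have h := integral_thermalAvg_sites μ β D σ hθ (Λ := Λ)
    (g := fun k => if k = i then f else fun _ => 1)
    (fun k => by by_cases hk : k = i <;> simp [hk, hf, BddMeas.const])
  have e1 : ∀ φ : Λ → X, ∏ k, (if k = i then f else fun _ => 1) (φ k) = f (φ i) := fun φ => by
    rw [Finset.prod_eq_single i] <;> simp +contextual
  rw [Finset.prod_eq_single i (by
    intro k _ hk; simp [hk, thermalAvg_one μ β hθ]) (by simp)] at h
  simpa only [e1, if_true] using h

lemma integral_thermalAvg_two_sites [DecidableEq Λ] (D : J → ℝ) (σ : J → ℝ≥0)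
    (hθ : ∀ m, Measurable (θ m)) {i j : Λ} (hij : i ≠ j) {f f' : X → ℝ} (hf : BddMeas f)
    (hf' : BddMeas f') :
    ∫ ω, thermalAvg (Measure.pi fun _ : Λ => μ) (fun a : Σ _ : Λ, J => β a.2) (siteTheta Λ θ) ω
        (fun φ => f (φ i) * f' (φ j)) ∂disorder (fun a : Σ _ : Λ, J => D a.2) (fun a => σ a.2)
      = (∫ ω, thermalAvg μ β θ ω f ∂disorder D σ)
        * ∫ ω, thermalAvg μ β θ ω f' ∂disorder D σ := by
  have h := integral_thermalAvg_sites μ β D σ hθ (Λ := Λ)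
    (g := fun k => if k = i then f else if k = j then f' else fun _ => 1)
    (fun k => by
      by_cases hk : k = i
      · simp [hk, hf]
      · by_cases hk' : k = j <;> simp [hk, hk', hf', hij.symm, BddMeas.const])
  have e1 : ∀ φ : Λ → X, ∏ k, (if k = i then f else if k = j then f' else fun _ => 1) (φ k)
      = f (φ i) * f' (φ j) := fun φ => by
    rw [Finset.prod_eq_mul i j hij (by rintro k _ ⟨h1, h2⟩; simp [h1, h2]) (by simp) (by simp)]
    simp [hij.symm]
  rw [Finset.prod_eq_mul i j hij (by
    rintro k _ ⟨h1, h2⟩; simp [h1, h2, thermalAvg_one μ β hθ]) (by simp) (by simp)] at h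
  simpa only [e1, if_true, hij.symm, if_false] using h

end Product

/-! ### The two-body and one-body models -/

section ModelFacts

instance : SecondCountableTopology Real.Angle :=
  inferInstanceAs (SecondCountableTopology (AddCircle (2 * Real.pi)))

variable {Λ : Type*} {Φ : AddSubgroup Real.Angle}

lemma compactSpace_of_isClosed (hΦ : IsClosed (Φ : Set Real.Angle)) : CompactSpace Φ := by
  have : Fact (0 < 2 * Real.pi) := ⟨Real.two_pi_pos⟩
  have : CompactSpace Real.Angle := inferInstanceAs (CompactSpace (AddCircle (2 * Real.pi)))
  exact isCompact_iff_compactSpace.1 hΦ.isCompact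

lemma measurable_pairPhase (e : Λ × Λ) (m : ℤ) : Measurable (pairPhase Φ e m) := by
  unfold pairPhase
  have h : ∀ i, Measurable fun φ : Λ → Φ => (φ i : Real.Angle) := fun i =>
    measurable_subtype_coe.comp (measurable_pi_apply i)
  exact (continuous_zsmul m).measurable.comp ((h e.1).sub (h e.2))

lemma measurable_zsmul_coe (m : ℤ) : Measurable fun φ : Φ => m • (φ : Real.Angle) :=
  (continuous_zsmul m).measurable.comp measurable_subtype_coe

lemma measurable_sitePhase (i : Λ) (m : ℤ) : Measurable (sitePhase Φ i m) :=
  (measurable_zsmul_coe m).comp (measurable_pi_apply i)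

lemma pairPhase_add (e : Λ × Λ) (m : ℤ) (φ ψ : Λ → Φ) :
    pairPhase Φ e m (φ + ψ) = pairPhase Φ e m φ + pairPhase Φ e m ψ := by
  simp only [pairPhase, Pi.add_apply, AddSubgroup.coe_add, ← smul_add]
  congr 1
  abel

lemma sitePhase_add (i : Λ) (m : ℤ) (φ ψ : Λ → Φ) :
    sitePhase Φ i m (φ + ψ) = sitePhase Φ i m φ + sitePhase Φ i m ψ := by
  simp only [sitePhase, Pi.add_apply, AddSubgroup.coe_add, smul_add]

lemma sum_bondTerm (B : Finset (Λ × Λ)) (β : Λ × Λ → ℤ →₀ ℝ≥0) (u : Λ × Λ → ℤ → ℝ) :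
    ∑ a : BondTerm B β, u a.1.1 a.2.1 = ∑ e ∈ B, ∑ m ∈ (β e).support, u e m := by
  rw [Fintype.sum_sigma, ← Finset.sum_coe_sort B]
  exact Finset.sum_congr rfl fun e _ => Finset.sum_coe_sort (β e.1).support (u e.1)

lemma sum_siteTerm [Fintype Λ] (β₀ : Λ → ℤ →₀ ℝ≥0) (u : Λ → ℤ → ℝ) :
    ∑ a : SiteTerm β₀, u a.1 a.2.1 = ∑ i, ∑ m ∈ (β₀ i).support, u i m := by
  rw [Fintype.sum_sigma]
  exact Finset.sum_congr rfl fun i _ => Finset.sum_coe_sort (β₀ i).support (u i)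

variable [Fintype Λ] (μ : Measure Φ) [IsFiniteMeasure μ]

lemma neZero_pi [NeZero μ] : NeZero (Measure.pi fun _ : Λ => μ) := by
  refine ⟨fun h => ?_⟩
  have h1 : (Measure.pi fun _ : Λ => μ) Set.univ = 0 := by rw [h]; simp
  rw [Measure.pi_univ, Finset.prod_eq_zero_iff] at h1
  obtain ⟨-, -, h2⟩ := h1
  exact NeZero.ne μ (Measure.measure_univ_eq_zero.1 h2)

end ModelFacts

section Models

variable {Λ : Type*} [Fintype Λ] {Φ : AddSubgroup Real.Angle} (μ : Measure Φ)
  [IsFiniteMeasure μ] [NeZero μ]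

lemma integrable_siteAvg (β₀ : Λ → ℤ →₀ ℝ≥0) (D₀ : Λ → ℤ → ℝ) (σ₀ : Λ → ℤ → ℝ≥0)
    {f : (Λ → Φ) → ℝ} (hf : BddMeas f) :
    Integrable (fun ω => siteAvg μ β₀ ω f) (siteDisorder β₀ D₀ σ₀) := by
  have := neZero_pi (Λ := Λ) μ
  have hθ : ∀ a : SiteTerm β₀, Measurable (sitePhase Φ a.1 a.2.1) := fun a =>
    measurable_sitePhase _ _
  unfold siteAvg siteDisorder
  exact integrable_thermalAvg _ hθ _ hf _

lemma integral_one_add_siteAvg (β₀ : Λ → ℤ →₀ ℝ≥0) (D₀ : Λ → ℤ → ℝ) (σ₀ : Λ → ℤ → ℝ≥0)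
    {f : (Λ → Φ) → ℝ} (hf : BddMeas f) :
    ∫ ω, (1 + siteAvg μ β₀ ω f) ∂siteDisorder β₀ D₀ σ₀
      = 1 + ∫ ω, siteAvg μ β₀ ω f ∂siteDisorder β₀ D₀ σ₀ := by
  have : IsProbabilityMeasure (siteDisorder β₀ D₀ σ₀) := by unfold siteDisorder; infer_instance
  rw [integral_add (integrable_const _) (integrable_siteAvg μ β₀ D₀ σ₀ hf)]
  simp

theorem gibbs_bogoliubov_bond_site [μ.IsAddLeftInvariant] (B : Finset (Λ × Λ))
    (β : Λ × Λ → ℤ →₀ ℝ≥0) (D : Λ × Λ → ℤ → ℝ) (σ : Λ × Λ → ℤ → ℝ≥0)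
    (hNL : ∀ e ∈ B, ∀ m ∈ (β e).support, D e m = β e m * (σ e m : ℝ) ^ 2)
    (β₀ : Λ → ℤ →₀ ℝ≥0) (D₀ : Λ → ℤ → ℝ) (σ₀ : Λ → ℤ → ℝ≥0)
    (hNL₀ : ∀ i, ∀ m ∈ (β₀ i).support, D₀ i m = β₀ i m * (σ₀ i m : ℝ) ^ 2) :
    (∫ ω, Real.log (siteZ μ β₀ ω) ∂siteDisorder β₀ D₀ σ₀)
        + 1 / 2 * ∑ e ∈ B, ∑ m ∈ (β e).support, (β e m * D e m)
            * ∫ ω, (1 + siteAvg μ β₀ ω fun φ => (pairPhase Φ e m φ).cos)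
                ∂siteDisorder β₀ D₀ σ₀
        - 1 / 2 * ∑ i, ∑ m ∈ (β₀ i).support, (β₀ i m * D₀ i m)
            * ∫ ω, (1 + siteAvg μ β₀ ω fun φ => (sitePhase Φ i m φ).cos)
                ∂siteDisorder β₀ D₀ σ₀
      ≤ ∫ ω, Real.log (bondZ μ B β ω) ∂bondDisorder B β D σ := by
  have := neZero_pi (Λ := Λ) μ
  have h := gibbs_bogoliubov (Measure.pi fun _ : Λ => μ)
    (θ₁ := fun a : BondTerm B β => pairPhase Φ a.1.1 a.2.1)
    (θ₂ := fun a : SiteTerm β₀ => sitePhase Φ a.1 a.2.1)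
    (β₁ := fun a => β a.1.1 a.2.1) (D₁ := fun a => D a.1.1 a.2.1)
    (σ₁ := fun a => σ a.1.1 a.2.1) (β₂ := fun a => β₀ a.1 a.2.1)
    (D₂ := fun a => D₀ a.1 a.2.1) (σ₂ := fun a => σ₀ a.1 a.2.1)
    (fun a => measurable_pairPhase _ _) (fun a => measurable_sitePhase _ _)
    (fun a => pairPhase_add _ _) (fun a => sitePhase_add _ _)
    (fun a => hNL _ a.1.2 _ a.2.2) (fun a => hNL₀ _ _ a.2.2)
  simp only [integral_one_add_siteAvg μ β₀ D₀ σ₀ (bddMeas_cos (measurable_pairPhase _ _)),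
    integral_one_add_siteAvg μ β₀ D₀ σ₀ (bddMeas_cos (measurable_sitePhase _ _))]
  rw [← sum_bondTerm B β fun e m => β e m * D e m * (1 + ∫ ω, siteAvg μ β₀ ω
      (fun φ => (pairPhase Φ e m φ).cos) ∂siteDisorder β₀ D₀ σ₀),
    ← sum_siteTerm β₀ fun i m => β₀ i m * D₀ i m * (1 + ∫ ω, siteAvg μ β₀ ω
      (fun φ => (sitePhase Φ i m φ).cos) ∂siteDisorder β₀ D₀ σ₀)]
  exact h

end Models

/-! ### The replica-symmetric bound -/

section ReplicaSymmetric

/-- The unit inverse temperatures on a finite set. -/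
def unitTemp (A : Finset ℤ) : ℤ →₀ ℝ≥0 where
  support := A
  toFun m := if m ∈ A then 1 else 0
  mem_support_toFun m := by simp

lemma unitTemp_of_mem {A : Finset ℤ} {m : ℤ} (hm : m ∈ A) : unitTemp A m = 1 := if_pos hm

variable {Λ : Type*} [Fintype Λ] {Φ : AddSubgroup Real.Angle} (μ : Measure Φ)
  (A : Finset ℤ) (h : ℤ → ℝ≥0)

/-- The expected thermal average of a single spin in the random fields `h`. -/
def singleSiteAvg (f : Φ → ℝ) : ℝ :=
  ∫ ω, thermalAvg μ (fun _ : {m // m ∈ A} => 1) (fun m (φ : Φ) => m.1 • (φ : Real.Angle)) ω f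
    ∂disorder (fun m : {m // m ∈ A} => (h m.1 : ℝ)) (fun m => NNReal.sqrt (h m.1))

lemma potential_unitTemp (ω : SiteTerm (fun _ : Λ => unitTemp A) → ℝ × ℝ) :
    potential (fun a : SiteTerm (fun _ : Λ => unitTemp A) => (unitTemp A a.2.1 : ℝ))
      (fun a => sitePhase Φ a.1 a.2.1) ω
    = potential (fun _ : Σ _ : Λ, {m // m ∈ A} => (1 : ℝ))
      (siteTheta Λ fun (m : {m // m ∈ A}) (φ : Φ) => m.1 • (φ : Real.Angle)) ω := by
  funext φ
  simp only [potential]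
  congr 1
  refine Finset.sum_congr rfl fun a _ => ?_
  have ha : (a.2.1 : ℤ) ∈ A := a.2.2
  have h1 : ((unitTemp A a.2.1 : ℝ≥0) : ℝ) = 1 := by rw [unitTemp_of_mem ha, NNReal.coe_one]
  exact congrArg₂ (· * ·) h1 rfl

lemma siteZ_unitTemp (ω : SiteTerm (fun _ : Λ => unitTemp A) → ℝ × ℝ) :
    siteZ μ (fun _ => unitTemp A) ω = partitionFn (Measure.pi fun _ : Λ => μ)
      (fun _ : Σ _ : Λ, {m // m ∈ A} => (1 : ℝ))
      (siteTheta Λ fun (m : {m // m ∈ A}) (φ : Φ) => m.1 • (φ : Real.Angle)) ω :=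
  partitionFn_congr _ (potential_unitTemp A ω)

lemma siteAvg_unitTemp (ω : SiteTerm (fun _ : Λ => unitTemp A) → ℝ × ℝ) (f : (Λ → Φ) → ℝ) :
    siteAvg μ (fun _ => unitTemp A) ω f = thermalAvg (Measure.pi fun _ : Λ => μ)
      (fun _ : Σ _ : Λ, {m // m ∈ A} => (1 : ℝ))
      (siteTheta Λ fun (m : {m // m ∈ A}) (φ : Φ) => m.1 • (φ : Real.Angle)) ω f :=
  thermalAvg_congr _ (potential_unitTemp A ω) f

variable [IsFiniteMeasure μ] [NeZero μ]

lemma integral_log_siteZ_unitTemp :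
    ∫ ω, Real.log (siteZ μ (fun _ => unitTemp A) ω)
      ∂siteDisorder (fun _ : Λ => unitTemp A) (fun _ m => h m) (fun _ m => NNReal.sqrt (h m))
      = Fintype.card Λ * singleSitePressure μ A h := by
  simp only [siteZ_unitTemp]
  exact pressure_sites μ (fun _ : {m // m ∈ A} => (1 : ℝ)) (fun m => (h m.1 : ℝ))
    (fun m => NNReal.sqrt (h m.1)) fun m => measurable_zsmul_coe m.1

lemma integral_siteAvg_sitePhase [DecidableEq Λ] (i : Λ) (m : ℤ) :
    ∫ ω, siteAvg μ (fun _ => unitTemp A) ω (fun φ => (sitePhase Φ i m φ).cos)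
      ∂siteDisorder (fun _ : Λ => unitTemp A) (fun _ m => h m) (fun _ m => NNReal.sqrt (h m))
      = singleSiteAvg μ A h fun φ => (m • (φ : Real.Angle)).cos := by
  simp only [siteAvg_unitTemp]
  exact integral_thermalAvg_one_site μ (fun _ : {m // m ∈ A} => (1 : ℝ)) (fun m => (h m.1 : ℝ))
    (fun m => NNReal.sqrt (h m.1)) (fun m => measurable_zsmul_coe m.1) i
    (bddMeas_cos (measurable_zsmul_coe m))

/-- The cosine of the difference splits into products of functions of two different sites, whose
expected thermal averages factor. The squared sine average is kept; its sign suffices later. -/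
lemma integral_siteAvg_pairPhase [DecidableEq Λ] {e : Λ × Λ} (he : e.1 ≠ e.2) (m : ℤ) :
    ∫ ω, siteAvg μ (fun _ => unitTemp A) ω (fun φ => (pairPhase Φ e m φ).cos)
      ∂siteDisorder (fun _ : Λ => unitTemp A) (fun _ m => h m) (fun _ m => NNReal.sqrt (h m))
      = singleSiteAvg μ A h (fun φ => (m • (φ : Real.Angle)).cos) ^ 2
        + singleSiteAvg μ A h (fun φ => (m • (φ : Real.Angle)).sin) ^ 2 := by
  have := neZero_pi (Λ := Λ) μ
  have hθ : ∀ m : {m // m ∈ A}, Measurable fun φ : Φ => m.1 • (φ : Real.Angle) := fun m =>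
    measurable_zsmul_coe m.1
  have hc := bddMeas_cos (measurable_zsmul_coe (Φ := Φ) m)
  have hs := bddMeas_sin (measurable_zsmul_coe (Φ := Φ) m)
  have h2 := fun {f : Φ → ℝ} (hf : BddMeas f) => integral_thermalAvg_two_sites μ
    (fun _ : {m // m ∈ A} => (1 : ℝ)) (fun m => (h m.1 : ℝ)) (fun m => NNReal.sqrt (h m.1))
    hθ he hf hf
  have hev : ∀ {f : Φ → ℝ}, BddMeas f → ∀ i, BddMeas fun φ : Λ → Φ => f (φ i) := fun hf i =>
    ⟨hf.measurable.comp (measurable_pi_apply i), hf.bdd.imp fun K hK φ => hK _⟩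
  have hθ' : ∀ a : Σ _ : Λ, {m // m ∈ A}, Measurable
      (siteTheta Λ (fun (m : {m // m ∈ A}) (φ : Φ) => m.1 • (φ : Real.Angle)) a) := fun a =>
    (hθ a.2).comp (measurable_pi_apply a.1)
  have hcos : (fun φ : Λ → Φ => (pairPhase Φ e m φ).cos) = fun φ =>
      (m • (φ e.1 : Real.Angle)).cos * (m • (φ e.2 : Real.Angle)).cos
        + (m • (φ e.1 : Real.Angle)).sin * (m • (φ e.2 : Real.Angle)).sin := by
    funext φ
    rw [pairPhase, smul_sub, sub_eq_add_neg, Real.Angle.cos_add, Real.Angle.cos_neg,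
      Real.Angle.sin_neg]
    ring
  have hcc := (hev hc e.1).mul (hev hc e.2)
  have hss := (hev hs e.1).mul (hev hs e.2)
  simp only [siteAvg_unitTemp, hcos, singleSiteAvg, pow_two]
  rw [← h2 hc, ← h2 hs, siteDisorder]
  refine Eq.trans ?_ (integral_add (integrable_thermalAvg _ hθ' _ hcc _)
    (integrable_thermalAvg _ hθ' _ hss _))
  exact integral_congr_ae (ae_of_all _ fun ω => thermalAvg_add _ hθ' _ ω hcc hss)

lemma abs_singleSiteAvg_le_one {f : Φ → ℝ} (hf : ∀ φ, |f φ| ≤ 1) :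
    |singleSiteAvg μ A h f| ≤ 1 := by
  have hb : ∀ ω, ‖thermalAvg μ (fun _ : {m // m ∈ A} => 1)
      (fun m (φ : Φ) => m.1 • (φ : Real.Angle)) ω f‖ ≤ 1 := fun ω =>
    abs_thermalAvg_le μ (fun m : {m // m ∈ A} => measurable_zsmul_coe m.1) (fun _ => 1) ω hf
  have := norm_integral_le_of_norm_le_const
    (μ := disorder (fun m : {m // m ∈ A} => (h m.1 : ℝ)) (fun m => NNReal.sqrt (h m.1)))
    (ae_of_all _ hb)
  rwa [probReal_univ, mul_one] at this

end ReplicaSymmetric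

/-- Double counting of incidences. Counting distinct endpoints, rather than taking `2` for each
bond, covers pairs with equal end points, which `B` may contain. -/
lemma sum_card_endpoints {Λ : Type*} [Fintype Λ] [DecidableEq Λ] (B : Finset (Λ × Λ)) (z : ℕ)
    (hz : ∀ i, (B.filter fun e => e.1 = i ∨ e.2 = i).card = z) :
    ∑ e ∈ B, ((Finset.univ.filter fun i : Λ => e.1 = i ∨ e.2 = i).card : ℝ)
      = Fintype.card Λ * z := by
  have h : ∑ e ∈ B, (Finset.univ.filter fun i : Λ => e.1 = i ∨ e.2 = i).card
      = ∑ i, (B.filter fun e => e.1 = i ∨ e.2 = i).card := by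
    simp only [Finset.card_filter]
    exact Finset.sum_comm
  simp only [hz, Finset.sum_const, Finset.card_univ, smul_eq_mul] at h
  exact_mod_cast h

lemma card_endpoints_le_two {Λ : Type*} [Fintype Λ] [DecidableEq Λ] (e : Λ × Λ) :
    (Finset.univ.filter fun i : Λ => e.1 = i ∨ e.2 = i).card ≤ 2 := by
  refine (Finset.card_le_card (t := {e.1, e.2}) fun i hi => ?_).trans Finset.card_le_two
  simp only [Finset.mem_filter, Finset.mem_univ, true_and] at hi
  simp only [Finset.mem_insert, Finset.mem_singleton]
  tauto

/-- The replica-symmetric free energy bounds the quenched free energy from above. -/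
theorem neg_integral_log_bondZ_le_rsFreeEnergy {Λ : Type*} [Fintype Λ] [DecidableEq Λ]
    {Φ : AddSubgroup Real.Angle} (μ : Measure Φ) [IsFiniteMeasure μ] [NeZero μ]
    [μ.IsAddLeftInvariant]
    (B : Finset (Λ × Λ)) (β : Λ × Λ → ℤ →₀ ℝ≥0) (D : Λ × Λ → ℤ → ℝ) (σ : Λ × Λ → ℤ → ℝ≥0)
    (hNL : ∀ e ∈ B, ∀ m ∈ (β e).support, D e m = β e m * (σ e m : ℝ) ^ 2)
    (z : ℕ) (x : ℤ →₀ ℝ≥0) (M : ℤ → ℝ≥0)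
    (hz : ∀ i, (B.filter fun e => e.1 = i ∨ e.2 = i).card = z)
    (hx : ∀ e ∈ B, ∀ m, β e m * D e m = x m) :
    -(∫ ω, Real.log (bondZ μ B β ω) ∂bondDisorder B β D σ)
      ≤ Fintype.card Λ * rsFreeEnergy μ z x M := by
  set h : ℤ → ℝ≥0 := fun m => z * x m * M m with hh
  set q : ℤ → ℝ := fun m =>
    singleSiteAvg μ x.support h fun φ => (m • (φ : Real.Angle)).cos with hq
  have hq1 : ∀ m, |q m| ≤ 1 := fun m =>
    abs_singleSiteAvg_le_one μ x.support h fun φ => abs_angle_cos_le_one _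
  -- The trial model has unit inverse temperatures and both mean and variance equal to `h m`, hence
  -- lies on the Nishimori line and has `x_{i,m} = h m`.
  have hGB := gibbs_bogoliubov_bond_site μ B β D σ hNL (fun _ => unitTemp x.support)
    (fun _ m => h m) (fun _ m => NNReal.sqrt (h m)) (fun i m hm => by
      have hm' : m ∈ x.support := hm
      rw [unitTemp_of_mem hm', ← NNReal.coe_pow, NNReal.sq_sqrt, NNReal.coe_one, one_mul])
  rw [integral_log_siteZ_unitTemp] at hGB
  simp only [integral_one_add_siteAvg μ (fun _ => unitTemp x.support) (fun _ m => (h m : ℝ))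
      (fun _ m => NNReal.sqrt (h m)) (bddMeas_cos (measurable_pairPhase _ _)),
    integral_one_add_siteAvg μ (fun _ => unitTemp x.support) (fun _ m => (h m : ℝ))
      (fun _ m => NNReal.sqrt (h m)) (bddMeas_cos (measurable_sitePhase _ _)),
    integral_siteAvg_sitePhase] at hGB
  set y : Λ × Λ → ℤ → ℝ := fun e m =>
    ∫ ω, siteAvg μ (fun _ => unitTemp x.support) ω (fun φ => (pairPhase Φ e m φ).cos)
      ∂siteDisorder (fun _ : Λ => unitTemp x.support) (fun _ m => h m)
        (fun _ m => NNReal.sqrt (h m)) with hy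
  have hbond : ∑ e ∈ B, ∑ m ∈ (β e).support, (β e m * D e m) * (1 + y e m)
      = ∑ m ∈ x.support, ∑ e ∈ B, (x m : ℝ) * (1 + y e m) := by
    rw [Finset.sum_comm (s := x.support)]
    refine Finset.sum_congr rfl fun e he => ?_
    simp only [hx e he]
    symm
    -- Where `x m ≠ 0`, the product `β e m * D e m` is nonzero, so `m` is in the support of `β e`;
    -- the other modes of `β e` have `x m = 0`.
    refine Finset.sum_subset (fun m hm => ?_) fun m _ hm => ?_
    · rw [Finsupp.mem_support_iff] at hm ⊢
      intro h0
      have := hx e he m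
      rw [h0, NNReal.coe_zero, zero_mul] at this
      exact hm (by exact_mod_cast this.symm)
    · rw [Finsupp.notMem_support_iff] at hm
      rw [hm, NNReal.coe_zero, zero_mul]
  have hsite : ∑ _i : Λ, ∑ m ∈ (unitTemp x.support).support,
        ((unitTemp x.support m : ℝ) * (h m : ℝ)) * (1 + q m)
      = ∑ m ∈ x.support, (Fintype.card Λ : ℝ) * (h m * (1 + q m)) := by
    rw [Finset.sum_const, Finset.card_univ, nsmul_eq_mul, Finset.mul_sum]
    refine Finset.sum_congr rfl fun m hm => ?_
    rw [unitTemp_of_mem hm, NNReal.coe_one, one_mul]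
  -- Each endpoint receives a quarter of `1 + q²`. For distinct endpoints `y = q² + (sine average)²
  -- ≥ q²`; for a loop the phase vanishes, so `y = 1 ≥ q²`.
  have hye : ∀ e m, ((Finset.univ.filter fun i : Λ => e.1 = i ∨ e.2 = i).card : ℝ) / 4
      * (1 + q m ^ 2) ≤ 1 / 2 * (1 + y e m) := by
    intro e m
    have hcard : ((Finset.univ.filter fun i : Λ => e.1 = i ∨ e.2 = i).card : ℝ) ≤ 2 := by
      exact_mod_cast card_endpoints_le_two e
    have hqy : q m ^ 2 ≤ y e m := by
      by_cases he : e.1 = e.2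
      · have hone : y e m = 1 := by
          have hZ : ∀ ω, siteAvg μ (fun _ : Λ => unitTemp x.support) ω
              (fun φ => (pairPhase Φ e m φ).cos) = 1 := fun ω => by
            have := neZero_pi (Λ := Λ) μ
            simp only [pairPhase, he, sub_self, smul_zero, Real.Angle.cos_zero]
            exact thermalAvg_one (Measure.pi fun _ : Λ => μ)
              (θ := fun a : SiteTerm (fun _ : Λ => unitTemp x.support) =>
                sitePhase Φ a.1 a.2.1) _ (fun a => measurable_sitePhase _ _) ω
          have : IsProbabilityMeasure (siteDisorder (fun _ : Λ => unitTemp x.support)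
              (fun _ m => (h m : ℝ)) fun _ m => NNReal.sqrt (h m)) := by
            unfold siteDisorder; infer_instance
          simp only [hy, hZ]
          simp
        rw [hone]
        exact (sq_le_one_iff_abs_le_one _).2 (hq1 m)
      · simp only [hy]
        rw [integral_siteAvg_pairPhase μ x.support h he m]
        exact le_add_of_nonneg_right (sq_nonneg _)
    nlinarith [sq_nonneg (q m)]
  have hterm : ∀ m, (Fintype.card Λ : ℝ) * (z / 4 * ((x m : ℝ) * (1 - 2 * M m - (M m : ℝ) ^ 2)))
      ≤ 1 / 2 * ∑ e ∈ B, (x m : ℝ) * (1 + y e m)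
        - 1 / 2 * ((Fintype.card Λ : ℝ) * (h m * (1 + q m))) := by
    intro m
    have h1 := Finset.sum_le_sum fun e (_ : e ∈ B) => hye e m
    rw [← Finset.sum_mul, ← Finset.sum_div, sum_card_endpoints B z hz, ← Finset.mul_sum] at h1
    have h2 := mul_le_mul_of_nonneg_left h1 (NNReal.coe_nonneg (x m))
    have h3 : (h m : ℝ) = z * x m * M m := by simp only [hh]; push_cast; rfl
    -- With `h = z x M`, the difference `(1 + q²) - 2M(1 + q) - (1 - 2M - M²)` is `(q - M)²`; this
    -- square is all that separates the two bounds once `y` has been bounded below.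
    have h4 : 0 ≤ (Fintype.card Λ : ℝ) * z / 4 * x m * (q m - M m) ^ 2 := by positivity
    rw [h3, ← Finset.mul_sum]
    nlinarith
  have hsum := Finset.sum_le_sum fun m (_ : m ∈ x.support) => hterm m
  rw [Finset.sum_sub_distrib, ← Finset.mul_sum, ← Finset.mul_sum, ← Finset.mul_sum,
    ← Finset.mul_sum, ← hbond, ← hsite] at hsum
  rw [rsFreeEnergy]
  simp only [hq] at hsum
  linarith

end

end GaugeGlass

open GaugeGlass in
theorem theorem4 {Λ : Type*} [Fintype Λ] [DecidableEq Λ]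
    -- the spin space: a compact subgroup of the circle, with a Haar measure
    (Φ : AddSubgroup Real.Angle) (hΦ : IsClosed (Φ : Set Real.Angle))
    (μ : Measure Φ) [μ.IsAddHaarMeasure]
    -- the two-body model: bonds, parameters, Nishimori-line condition
    (B : Finset (Λ × Λ)) (β : Λ × Λ → ℤ →₀ ℝ≥0) (D : Λ × Λ → ℤ → ℝ) (σ : Λ × Λ → ℤ → ℝ≥0)
    (hNL : ∀ e ∈ B, ∀ m ∈ (β e).support, D e m = β e m * (σ e m : ℝ) ^ 2)
    -- the one-body trial model: parameters, Nishimori-line condition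
    (β₀ : Λ → ℤ →₀ ℝ≥0) (D₀ : Λ → ℤ → ℝ) (σ₀ : Λ → ℤ → ℝ≥0)
    (hNL₀ : ∀ i, ∀ m ∈ (β₀ i).support, D₀ i m = β₀ i m * (σ₀ i m : ℝ) ^ 2) :
    -- all the quantities are well defined
    (∀ ω, 0 < bondZ μ B β ω) ∧
    (∀ ω, 0 < siteZ μ β₀ ω) ∧
    Integrable (fun ω => Real.log (bondZ μ B β ω)) (bondDisorder B β D σ) ∧
    Integrable (fun ω => Real.log (siteZ μ β₀ ω)) (siteDisorder β₀ D₀ σ₀) ∧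
    (∀ e m, Integrable (fun ω => siteAvg μ β₀ ω fun φ => (pairPhase Φ e m φ).cos)
      (siteDisorder β₀ D₀ σ₀)) ∧
    (∀ i m, Integrable (fun ω => siteAvg μ β₀ ω fun φ => (sitePhase Φ i m φ).cos)
      (siteDisorder β₀ D₀ σ₀)) ∧
    -- the Gibbs–Bogoliubov inequality, with `x_{ij,m} = β_{ij,m} D_{ij,m}` and
    -- `x_{i,m} = β_{i,m} D_{i,m}`
    (∫ ω, Real.log (siteZ μ β₀ ω) ∂siteDisorder β₀ D₀ σ₀)
        + 1 / 2 * ∑ e ∈ B, ∑ m ∈ (β e).support, (β e m * D e m)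
            * ∫ ω, (1 + siteAvg μ β₀ ω fun φ => (pairPhase Φ e m φ).cos)
                ∂siteDisorder β₀ D₀ σ₀
        - 1 / 2 * ∑ i, ∑ m ∈ (β₀ i).support, (β₀ i m * D₀ i m)
            * ∫ ω, (1 + siteAvg μ β₀ ω fun φ => (sitePhase Φ i m φ).cos)
                ∂siteDisorder β₀ D₀ σ₀
      ≤ ∫ ω, Real.log (bondZ μ B β ω) ∂bondDisorder B β D σ ∧
    -- the replica-symmetric mean-field free energy is an upper bound of the quenched free energy
    -- if each site lies in `z` bonds and `x_{ij,m} = x_m` is the same for all bonds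
    (∀ (z : ℕ) (x : ℤ →₀ ℝ≥0) (M : ℤ → ℝ≥0),
      (∀ i, (B.filter fun e => e.1 = i ∨ e.2 = i).card = z) →
      (∀ e ∈ B, ∀ m, β e m * D e m = x m) →
      -(∫ ω, Real.log (bondZ μ B β ω) ∂bondDisorder B β D σ)
        ≤ Fintype.card Λ * rsFreeEnergy μ z x M) := by
  have : CompactSpace Φ := compactSpace_of_isClosed hΦ
  have : IsFiniteMeasure μ := CompactSpace.isFiniteMeasure
  -- A Haar measure charges nonempty open sets; finiteness comes from compactness of the closed
  -- subgroup.
  have : NeZero μ := ⟨fun h0 => (isOpen_univ.measure_pos μ Set.univ_nonempty).ne' (by simp [h0])⟩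
  have := neZero_pi (Λ := Λ) μ
  refine ⟨fun ω => partitionFn_pos _ (fun a => measurable_pairPhase _ _) _ ω,
    fun ω => partitionFn_pos _ (fun a => measurable_sitePhase _ _) _ ω,
    integrable_log_partitionFn _ (fun a => measurable_pairPhase _ _) _ _ _,
    integrable_log_partitionFn _ (fun a => measurable_sitePhase _ _) _ _ _,
    fun e m => integrable_siteAvg μ β₀ D₀ σ₀ (bddMeas_cos (measurable_pairPhase e m)),
    fun i m => integrable_siteAvg μ β₀ D₀ σ₀ (bddMeas_cos (measurable_sitePhase i m)),
    gibbs_bogoliubov_bond_site μ B β D σ hNL β₀ D₀ σ₀ hNL₀,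
    fun z x M hz hx => neg_integral_log_bondZ_le_rsFreeEnergy μ B β D σ hNL z x M hz hx⟩
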